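/- Let $A$, $B$ be finite alphabets and $C$ an alphabet. A \emph{substitution} on $A$ is a map $\sigma : A\to A^*$, extended to words and (since it is then non-erasing) to sequences by concatenation, such that $|\sigma^n(a)|\to+\infty$ for every $a\in A$. A \emph{proper fixed point} of $\sigma$ is a sequence $y\in A^{\mathbb N}$ with $\sigma(y)=y$ in which every letter of $A$ occurs. A letter $a$ has \emph{growth type} $(d,\theta)$, with $d\in\mathbb N$ and $\theta>0$ real, if $|\sigma^n(a)|$ is of exact order $n^d\theta^n$, i.e. there are $c_1,c_2>0$ with $c_1n^d\theta^n\le|\sigma^n(a)|\le c_2n^d\theta^n$ for all large $n$. The growth type of $\sigma$ is the greatest growth type of a letter, where $(d,\theta)<(d',\theta')$ means $\theta<\theta'$, or $\theta=\theta'$ and $d<d'$. A \emph{Perron number} is a positive real algebraic integer strictly greater than the modulus of each of its other algebraic conjugates. Numbers $\alpha,\beta$ are \emph{multiplicatively independent} if $\alpha^k\neq\beta^l$ for all integers $k,l>0$. Let $\alpha$ and $\beta$ be multiplicatively independent Perron numbers. Let $\sigma$ and $\tau$ be substitutions on $A$ and $B$ with growth types $(d,\alpha)$ and $(e,\beta)$,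 and let $y$ and $z$ be proper fixed points of $\sigma$ and $\tau$ respectively. Let $\phi:A\to C$ and $\psi:B\to C$ be letter-to-letter maps such that $\phi(y)=\psi(z)=x$. Then every letter $c\in C$ that occurs infinitely often in $x$ occurs in $x$ with bounded gaps: there is $K$ such that every block of $K+1$ consecutive positions of $x$ contains an occurrence of $c$. -/

import Mathlib

open Filter Asymptotics

namespace Subst

/-- The extension of a morphism `σ : A → B*` to words, by concatenation. -/
def onWord {A B : Type*} (σ : A → List B) (w : List A) : List B := w.flatMap σ

/-- The word `σⁿ(a)`. -/
def iter {A : Type*} (σ : A → List A) (n : ℕ) (a : A) : List A := (onWord σ)^[n] [a]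

/-- A substitution: a morphism such that `|σⁿ(a)| → ∞` for every letter `a`.
In particular `σ a ≠ []` for every `a`. -/
def IsSubstitution {A : Type*} (σ : A → List A) : Prop :=
  ∀ a, Tendsto (fun n => (iter σ n a).length) atTop atTop

/-- The prefix `x₀ ⋯ xₙ₋₁` of length `n` of a sequence. -/
def pre {A : Type*} (x : ℕ → A) (n : ℕ) : List A := (List.range n).map x

/-- `σ(y) = x` for sequences: the image of every prefix of `y` is a prefix of `x`.
When no `σ a` is empty, this determines `x` as the infinite concatenation `σ(y₀)σ(y₁)⋯`. -/
def MapsSeq {A B : Type*} (σ : A → List B) (y : ℕ → A) (x : ℕ → B) : Prop :=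
  ∀ n, onWord σ (pre y n) = pre x (onWord σ (pre y n)).length

/-- A proper fixed point of `σ`: `σ(y) = y`, and every letter of the alphabet occurs in `y`. -/
def IsProperFixedPoint {A : Type*} (σ : A → List A) (y : ℕ → A) : Prop :=
  MapsSeq σ y y ∧ ∀ a, ∃ n, y n = a

/-- The letter `a` has growth type `(d, θ)`: `|σⁿ(a)|` is of exact order `n ^ d * θ ^ n`, that is,
between two positive constant multiples of it for large `n`. -/
def LetterGrowthType {A : Type*} (σ : A → List A) (a : A) (d : ℕ) (θ : ℝ) : Prop :=
  0 < θ ∧ (fun n : ℕ => ((iter σ n a).length : ℝ)) =Θ[atTop] (fun n : ℕ => (n : ℝ) ^ d * θ ^ n)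

/-- `(d, θ)` is the growth type of `σ`: the greatest growth type of a letter, where growth types are
compared first by `θ`, then by `d`. -/
def HasGrowthType {A : Type*} (σ : A → List A) (d : ℕ) (θ : ℝ) : Prop :=
  (∃ a, LetterGrowthType σ a d θ) ∧
    ∀ a d' θ', LetterGrowthType σ a d' θ' → θ' < θ ∨ (θ' = θ ∧ d' ≤ d)

/-- A Perron number: a positive real algebraic integer that is strictly greater than the modulus of
each of its other algebraic conjugates. -/
def IsPerron (α : ℝ) : Prop :=
  0 < α ∧ IsIntegral ℤ α ∧
    ∀ z : ℂ, Polynomial.aeval z (minpoly ℚ α) = 0 → z ≠ (α : ℂ) → ‖z‖ < α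

/-- `α` and `β` are multiplicatively independent: `α ^ k ≠ β ^ l` for all integers `k, l > 0`. -/
def MulIndep (α β : ℝ) : Prop := ∀ k l : ℕ, 0 < k → 0 < l → α ^ k ≠ β ^ l

/-- The letter `c` appears in `x` with bounded gaps: for some `K`, every window of `K + 1`
consecutive positions contains an occurrence of `c`. -/
def BoundedGaps {C : Type*} (x : ℕ → C) (c : C) : Prop :=
  ∃ K : ℕ, ∀ n, ∃ m, n ≤ m ∧ m ≤ n + K ∧ x m = c

end Subst

/-! ### Exponential-polynomial asymptotics and their closure properties. -/

namespace Subst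

open Topology

/-! Let `S` be the set of positions of `c`. At each level `n`, `σ` cuts `y` into blocks with cut
points `g^[n] j`, and membership in `S` depends only on the letter of `y`; likewise for `z`, with
`h` in place of `g`. After passing to a power of the substitution, the relation "`b` occurs in the
image of `a`" is idempotent. Hence whether a block of level at least 1 is free (misses `S`) does not
depend on the level. Idempotence also removes periodicity from the incidence matrix, so a
Perron–Frobenius argument (`hasExpPolyLim_of_transitive`) gives block lengths true asymptotics, and
cut points satisfy `g^[n] k ~ Λ k * n ^ d * α ^ n` and `h^[m] k ~ M k * m ^ e * β ^ m` (`IsGauge`;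
here `α`, `β` stand for powers of the given numbers). By multiplicative independence the ratios of
the two scales are dense (`exists_scale_between`), so suitable strict inequalities between values of
`Λ` and `M` can be realised as inclusions between blocks of `y` and of `z`.

Suppose `S` is infinite with unbounded gaps. Then both sequences have free blocks. A free block of
`z` with `M j' < M (j' + 1)` would swallow a block of `y` that meets `S`, because `Λ` is unbounded
with bounded steps (`not_freeBlock_of_lt_succ`); so `M` is constant across free blocks. Moreover an
`S`-free interval inside one block of level `n` is at most a constant times a dominant free block of
that level (`exists_gap_bound`). Levels `n`, `m` can be chosen so that the dominant free block of
`z` at level `m` lies in one block of `y` of level `n`, while the dominant free block of `y` at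
level `n + k` lies in the first block of `z` of level `m`. Applying the bound twice, the latter has
length at most a constant times its length at level `n`, with a constant independent of `k`.
Exponential growth contradicts this for large `k`. -/

/-- `u n ~ κ * n ^ d * θ ^ n`, for `κ ≠ 0`. -/
def ExpPolyLim (u : ℕ → ℝ) (d : ℕ) (θ κ : ℝ) : Prop :=
  Tendsto (fun n : ℕ => u n / ((n : ℝ) ^ d * θ ^ n)) atTop (𝓝 κ)

/-- `u` vanishes or is asymptotic to a positive multiple of some `n ^ d * θ ^ n`. -/
def HasExpPolyLim (u : ℕ → ℝ) : Prop :=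
  u = 0 ∨ ∃ d θ κ, 0 < θ ∧ 0 < κ ∧ ExpPolyLim u d θ κ

theorem tendsto_scale_div_of_lt {d d' : ℕ} {θ θ' : ℝ} (hθ : 0 < θ) (h : θ < θ') :
    Tendsto (fun n : ℕ => ((n : ℝ) ^ d * θ ^ n) / ((n : ℝ) ^ d' * θ' ^ n)) atTop (𝓝 0) := by
  have hθ' : 0 < θ' := hθ.trans h
  have h1 := tendsto_pow_const_div_const_pow_of_one_lt d ((one_lt_div hθ).2 h)
  refine squeeze_zero' (Eventually.of_forall fun n => by positivity) ?_ h1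
  filter_upwards [eventually_ge_atTop 1] with n hn
  have hn1 : (1 : ℝ) ≤ (n : ℝ) ^ d' := one_le_pow₀ (by exact_mod_cast hn)
  rw [div_pow, div_div_eq_mul_div]
  gcongr
  exact le_mul_of_one_le_left (by positivity) hn1

theorem tendsto_scale_div_of_degree_lt {d d' : ℕ} {θ : ℝ} (hθ : 0 < θ) (h : d < d') :
    Tendsto (fun n : ℕ => ((n : ℝ) ^ d * θ ^ n) / ((n : ℝ) ^ d' * θ ^ n)) atTop (𝓝 0) := by
  have h1 : Tendsto (fun n : ℕ => ((n : ℝ) ^ (d' - d))⁻¹) atTop (𝓝 0) :=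
    (tendsto_inv_atTop_zero.comp (tendsto_pow_atTop (by omega))).comp tendsto_natCast_atTop_atTop
  refine h1.congr' ?_
  filter_upwards [eventually_ge_atTop 1] with n hn
  have hn1 : (0 : ℝ) < n := by exact_mod_cast hn
  rw [mul_div_mul_right _ _ (by positivity)]
  conv_rhs => rw [show d' = (d' - d) + d by omega, pow_add]
  field_simp

theorem scale_pos {d : ℕ} {θ : ℝ} (hθ : 0 < θ) {n : ℕ} (hn : 1 ≤ n) : 0 < (n : ℝ) ^ d * θ ^ n := by
  have : (0 : ℝ) < n := by exact_mod_cast hn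
  positivity

/-- The limit `0` records growth strictly below a scale, so that sequences of different growth can
be added on the larger scale. -/
theorem ExpPolyLim.rescale {u : ℕ → ℝ} {d d' : ℕ} {θ θ' κ : ℝ} (hu : ExpPolyLim u d θ κ)
    (hθ : 0 < θ)
    (h : Tendsto (fun n : ℕ => ((n : ℝ) ^ d * θ ^ n) / ((n : ℝ) ^ d' * θ' ^ n)) atTop (𝓝 0)) :
    ExpPolyLim u d' θ' 0 := by
  have := hu.mul h
  rw [mul_zero] at this
  refine this.congr' ?_
  filter_upwards [eventually_ge_atTop 1] with n hn
  exact div_mul_div_cancel₀ (scale_pos hθ hn).ne'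

theorem ExpPolyLim.add {u v : ℕ → ℝ} {d : ℕ} {θ κ κ' : ℝ} (hu : ExpPolyLim u d θ κ)
    (hv : ExpPolyLim v d θ κ') : ExpPolyLim (u + v) d θ (κ + κ') := by
  refine (Tendsto.add hu hv).congr fun n => ?_
  simp [add_div]

theorem ExpPolyLim.const_mul {u : ℕ → ℝ} {d : ℕ} {θ κ : ℝ} (hu : ExpPolyLim u d θ κ) (c : ℝ) :
    ExpPolyLim (fun n => c * u n) d θ (c * κ) := by
  refine (Tendsto.const_mul c hu).congr fun n => ?_
  rw [mul_div_assoc]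

/-- Two growth types are comparable. -/
theorem scale_trichotomy (d d' : ℕ) {θ θ' : ℝ} (hθ : 0 < θ) (hθ' : 0 < θ') :
    Tendsto (fun n : ℕ => ((n : ℝ) ^ d * θ ^ n) / ((n : ℝ) ^ d' * θ' ^ n)) atTop (𝓝 0) ∨
    (d = d' ∧ θ = θ') ∨
    Tendsto (fun n : ℕ => ((n : ℝ) ^ d' * θ' ^ n) / ((n : ℝ) ^ d * θ ^ n)) atTop (𝓝 0) := by
  rcases lt_trichotomy θ θ' with h | h | h
  · exact Or.inl (tendsto_scale_div_of_lt hθ h)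
  · subst h
    rcases lt_trichotomy d d' with h | h | h
    · exact Or.inl (tendsto_scale_div_of_degree_lt hθ h)
    · exact Or.inr (Or.inl ⟨h, rfl⟩)
    · exact Or.inr (Or.inr (tendsto_scale_div_of_degree_lt hθ h))
  · exact Or.inr (Or.inr (tendsto_scale_div_of_lt hθ' h))

/-- The constants are positive, so leading terms cannot cancel. -/
theorem HasExpPolyLim.add {u v : ℕ → ℝ} (hu : HasExpPolyLim u) (hv : HasExpPolyLim v) :
    HasExpPolyLim (u + v) := by
  rcases hu with rfl | ⟨d, θ, κ, hθ, hκ, hu⟩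
  · simpa using hv
  rcases hv with rfl | ⟨d', θ', κ', hθ', hκ', hv⟩
  · exact Or.inr ⟨d, θ, κ, hθ, hκ, by simpa using hu⟩
  rcases scale_trichotomy d d' hθ hθ' with h | ⟨rfl, rfl⟩ | h
  · exact Or.inr ⟨d', θ', κ', hθ', hκ', by simpa using (hu.rescale hθ h).add hv⟩
  · exact Or.inr ⟨d, θ, κ + κ', hθ, by positivity, hu.add hv⟩
  · exact Or.inr ⟨d, θ, κ, hθ, hκ, by simpa using hu.add (hv.rescale hθ' h)⟩

theorem HasExpPolyLim.const_mul {u : ℕ → ℝ} (hu : HasExpPolyLim u) {c : ℝ} (hc : 0 ≤ c) :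
    HasExpPolyLim (fun n => c * u n) := by
  rcases hu with rfl | ⟨d, θ, κ, hθ, hκ, hu⟩
  · left; ext; simp
  rcases hc.eq_or_lt with rfl | hc
  · left; ext; simp
  · exact Or.inr ⟨d, θ, c * κ, hθ, by positivity, hu.const_mul c⟩

theorem HasExpPolyLim.sum {ι : Type*} (s : Finset ι) {u : ι → ℕ → ℝ}
    (hu : ∀ i ∈ s, HasExpPolyLim (u i)) : HasExpPolyLim (fun n => ∑ i ∈ s, u i n) := by
  classical
  induction s using Finset.induction_on with
  | empty => left; ext; simp
  | insert i s hi ih =>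
    have := (hu i (by simp)).add (ih fun j hj => hu j (by simp [hj]))
    simp only [Finset.sum_insert hi]
    exact this

theorem tendsto_succ_div_self : Tendsto (fun n : ℕ => ((n : ℝ) + 1) / n) atTop (𝓝 1) := by
  have h := (tendsto_inv_atTop_nhds_zero_nat (𝕜 := ℝ)).const_add 1
  rw [add_zero] at h
  refine h.congr' ?_
  filter_upwards [eventually_ge_atTop 1] with n hn
  have : (n : ℝ) ≠ 0 := by positivity
  field_simp

theorem tendsto_scale_succ (d : ℕ) {θ : ℝ} (hθ : 0 < θ) :
    Tendsto (fun n : ℕ => (((n + 1 : ℕ) : ℝ) ^ d * θ ^ (n + 1)) / ((n : ℝ) ^ d * θ ^ n)) atTop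
      (𝓝 θ) := by
  have h := (tendsto_succ_div_self.pow d).mul_const θ
  rw [one_pow, one_mul] at h
  refine h.congr' ?_
  filter_upwards [eventually_ge_atTop 1] with n hn
  have : (n : ℝ) ≠ 0 := by positivity
  push_cast
  rw [div_pow]
  field_simp
  ring

theorem ExpPolyLim.succ {u : ℕ → ℝ} {d : ℕ} {θ κ : ℝ} (hθ : 0 < θ) (hu : ExpPolyLim u d θ κ) :
    ExpPolyLim (fun n => u (n + 1)) d θ (κ * θ) := by
  have h1 := ((tendsto_add_atTop_iff_nat 1).2 hu).mul (tendsto_scale_succ d hθ)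
  refine h1.congr fun n => ?_
  exact div_mul_div_cancel₀ (scale_pos hθ (by omega)).ne'

theorem ExpPolyLim.shift {u : ℕ → ℝ} {d : ℕ} {θ κ : ℝ} (hθ : 0 < θ) (hu : ExpPolyLim u d θ κ)
    (k : ℕ) : ExpPolyLim (fun n => u (n + k)) d θ (κ * θ ^ k) := by
  induction k with
  | zero => simpa using hu
  | succ k ih =>
    have := ih.succ hθ
    rw [mul_assoc, ← pow_succ] at this
    refine this.congr fun n => ?_
    simp only [add_right_comm n 1 k, add_assoc]

theorem ExpPolyLim.of_succ {u : ℕ → ℝ} {d : ℕ} {θ κ : ℝ} (hθ : 0 < θ)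
    (hu : ExpPolyLim (fun n => u (n + 1)) d θ κ) : ExpPolyLim u d θ (κ / θ) := by
  have h1 := Tendsto.div hu (tendsto_scale_succ d hθ) hθ.ne'
  refine (tendsto_add_atTop_iff_nat 1).1 (h1.congr' ?_)
  filter_upwards [eventually_ge_atTop 1] with n hn
  have h2 := (scale_pos (d := d) hθ hn).ne'
  simp only [Pi.div_apply]
  rw [div_div_div_cancel_right₀ h2]

/-- The hypothesis `h0` excludes a sequence that is nonzero at `0` only: it is neither zero nor
asymptotic to a positive multiple of a scale. -/
theorem HasExpPolyLim.of_succ {u : ℕ → ℝ} (h0 : u 0 = 0 ∨ ∃ n, u (n + 1) ≠ 0)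
    (hu : HasExpPolyLim (fun n => u (n + 1))) : HasExpPolyLim u := by
  rcases hu with h | ⟨d, θ, κ, hθ, hκ, hu⟩
  · left
    have h' : ∀ n, u (n + 1) = 0 := fun n => congrFun h n
    ext n
    cases n with
    | zero => exact h0.resolve_right (by simpa using h')
    | succ n => exact h' n
  · exact Or.inr ⟨d, θ, κ / θ, hθ, by positivity, hu.of_succ hθ⟩

/-- A sequence with an asymptotic scale is bounded by it, up to a constant, from `n = 1` on. -/
theorem ExpPolyLim.exists_le {u : ℕ → ℝ} {d : ℕ} {θ κ : ℝ} (hθ : 0 < θ)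
    (hu : ExpPolyLim u d θ κ) :
    ∃ C, 0 < C ∧ ∀ n, 1 ≤ n → |u n| ≤ C * ((n : ℝ) ^ d * θ ^ n) := by
  obtain ⟨C, hC⟩ := (hu.abs.bddAbove_range)
  refine ⟨max C 1, by positivity, fun n hn => ?_⟩
  have h1 : |u n / ((n : ℝ) ^ d * θ ^ n)| ≤ C := hC ⟨n, rfl⟩
  have h2 := scale_pos (d := d) hθ hn
  rw [abs_div, abs_of_pos h2, div_le_iff₀ h2] at h1
  exact h1.trans (by gcongr; exact le_max_left _ _)

end Subst

/-! ### Convolutions with an asymptotically geometric sequence. -/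

namespace Subst

open Topology

theorem ExpPolyLim.exists_le_succ {u : ℕ → ℝ} {d : ℕ} {θ κ : ℝ} (hθ : 0 < θ)
    (hu : ExpPolyLim u d θ κ) :
    ∃ C, 0 < C ∧ ∀ n : ℕ, |u n| ≤ C * (((n : ℝ) + 1) ^ d * θ ^ n) := by
  obtain ⟨C, hC, h⟩ := hu.exists_le hθ
  refine ⟨max C |u 0|, by positivity, fun n => ?_⟩
  rcases Nat.eq_zero_or_pos n with rfl | hn
  · simp
  · refine (h n hn).trans ?_
    gcongr
    · exact le_max_left _ _
    · linarith

/-- Tannery's theorem, that is, dominated convergence for series. -/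
theorem tendsto_sum_mul_of_summable {v : ℕ → ℝ} {h : ℕ → ℕ → ℝ} {C L : ℝ}
    (hv : Summable fun n => |v n|) (hC : ∀ n j, j < n → |h n j| ≤ C)
    (hL : ∀ j, Tendsto (fun n => h n j) atTop (𝓝 L)) :
    Tendsto (fun n => ∑ j ∈ Finset.range n, v j * h n j) atTop (𝓝 ((∑' j, v j) * L)) := by
  have key := tendsto_tsum_of_dominated_convergence (𝓕 := atTop)
    (f := fun n j => if j < n then v j * h n j else 0) (g := fun j => v j * L)
    (bound := fun j => |v j| * |C|) (hv.mul_right _) (fun j => by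
      refine ((hL j).const_mul (v j)).congr' ?_
      filter_upwards [eventually_gt_atTop j] with n hn
      simp [hn]) (Eventually.of_forall fun n j => by
      split_ifs with hj
      · rw [Real.norm_eq_abs, abs_mul]
        exact mul_le_mul_of_nonneg_left ((hC n j hj).trans (le_abs_self C)) (abs_nonneg _)
      · simpa using by positivity)
  rw [tsum_mul_right] at key
  refine key.congr fun n => ?_
  rw [tsum_eq_sum (s := Finset.range n) (fun j hj => if_neg (by simpa using hj))]
  exact Finset.sum_congr rfl fun j hj => if_pos (by simpa using hj)

theorem tendsto_sub_one_sub (j : ℕ) : Tendsto (fun n : ℕ => n - 1 - j) atTop atTop := by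
  refine tendsto_atTop.2 fun b => ?_
  filter_upwards [eventually_ge_atTop (b + 1 + j)] with n hn
  omega

theorem summable_abs_div_pow {g : ℕ → ℝ} {d : ℕ} {θ κ μ : ℝ} (hθ : 0 < θ) (hμ : θ < μ)
    (hg : ExpPolyLim g d θ κ) : Summable fun n : ℕ => |g n / μ ^ (n + 1)| := by
  have hμ0 : 0 < μ := hθ.trans hμ
  obtain ⟨C, hC, h⟩ := hg.exists_le hθ
  have hr : ‖θ / μ‖ < 1 := by
    rw [Real.norm_of_nonneg (by positivity), div_lt_one hμ0]; exact hμ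
  refine Summable.of_norm_bounded_eventually_nat
    ((summable_pow_mul_geometric_of_norm_lt_one d hr).mul_left (C / μ)) ?_
  filter_upwards [eventually_ge_atTop 1] with n hn
  rw [norm_abs_eq_norm, Real.norm_eq_abs, abs_div, abs_of_pos (a := μ ^ (n + 1)) (by positivity),
    div_le_iff₀ (by positivity)]
  refine (h n hn).trans (le_of_eq ?_)
  rw [div_pow, pow_succ]
  field_simp

/-- Convolution of a geometric sequence with a faster one. -/
theorem ExpPolyLim.conv_of_lt {u g : ℕ → ℝ} {d : ℕ} {θ μ κ ρ : ℝ} (hμ : 0 < μ) (hμθ : μ < θ)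
    (hu : ExpPolyLim u 0 μ ρ) (hg : ExpPolyLim g d θ κ) :
    ExpPolyLim (fun n => ∑ i ∈ Finset.range n, u (n - 1 - i) * g i) d θ
      ((∑' j, u j / θ ^ (j + 1)) * κ) := by
  have hθ : 0 < θ := hμ.trans hμθ
  obtain ⟨C, hC, h⟩ := hg.exists_le_succ hθ
  -- Dividing by `n ^ d` rather than `(n - 1 - j) ^ d` keeps the quotients bounded uniformly in `j <
  -- n`; for fixed `j` the two powers are equivalent.
  have key := tendsto_sum_mul_of_summable (v := fun j => u j / θ ^ (j + 1))
    (h := fun n j => g (n - 1 - j) / ((n : ℝ) ^ d * θ ^ (n - 1 - j))) (C := C) (L := κ)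
    (summable_abs_div_pow hμ hμθ hu) (fun n j hj => by
      have hn : (0 : ℝ) < n := by exact_mod_cast (by omega : 0 < n)
      rw [abs_div, abs_of_pos (a := (n : ℝ) ^ d * _) (by positivity), div_le_iff₀ (by positivity)]
      refine (h _).trans ?_
      gcongr
      exact_mod_cast (by omega : n - 1 - j + 1 ≤ n)) (fun j => by
      have h1 : Tendsto (fun m : ℕ => ((m : ℝ) / ((m + (1 + j) : ℕ) : ℝ)) ^ d) atTop (𝓝 (1 ^ d)) :=
        Tendsto.pow (by simpa using tendsto_natCast_div_add_atTop (𝕜 := ℝ) ((1 + j : ℕ) : ℝ)) d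
      refine (tendsto_add_atTop_iff_nat (1 + j)).1 ?_
      have h2 := Tendsto.mul hg h1
      rw [one_pow, mul_one] at h2
      refine h2.congr' ?_
      filter_upwards [eventually_ge_atTop 1] with m hm
      have hm : (0 : ℝ) < m := by exact_mod_cast hm
      rw [show m + (1 + j) - 1 - j = m by omega, div_pow]
      field_simp)
  refine key.congr fun n => ?_
  rw [Finset.sum_div, ← Finset.sum_range_reflect]
  refine Finset.sum_congr rfl fun j hj => ?_
  have hj : j < n := by simpa using hj
  rw [show n - 1 - (n - 1 - j) = j by omega]
  have : θ ^ n = θ ^ (n - 1 - j + 1) * θ ^ j := by rw [← pow_add]; congr 1; omega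
  rw [this]
  have hn : (0 : ℝ) < n := by exact_mod_cast (by omega : 0 < n)
  field_simp

/-- Convolution of a geometric sequence with a slower one. -/
theorem ExpPolyLim.conv_of_gt {u g : ℕ → ℝ} {d : ℕ} {θ μ κ ρ : ℝ} (hθ : 0 < θ) (hμθ : θ < μ)
    (hu : ExpPolyLim u 0 μ ρ) (hg : ExpPolyLim g d θ κ) :
    ExpPolyLim (fun n => ∑ i ∈ Finset.range n, u (n - 1 - i) * g i) 0 μ
      ((∑' j, g j / μ ^ (j + 1)) * ρ) := by
  have hμ : 0 < μ := hθ.trans hμθ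
  obtain ⟨C, hC, h⟩ := hu.exists_le_succ hμ
  have key := tendsto_sum_mul_of_summable (v := fun j => g j / μ ^ (j + 1))
    (h := fun n j => u (n - 1 - j) / μ ^ (n - 1 - j)) (C := C) (L := ρ)
    (summable_abs_div_pow hθ hμθ hg) (fun n j hj => by
      rw [abs_div, abs_of_pos (a := μ ^ _) (by positivity), div_le_iff₀ (by positivity)]
      simpa using h (n - 1 - j)) (fun j => by
      have := Tendsto.comp hu (tendsto_sub_one_sub j)
      simpa [Function.comp_def] using this)
  refine key.congr fun n => ?_
  rw [Finset.sum_div]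
  refine Finset.sum_congr rfl fun j hj => ?_
  have hj : j < n := by simpa using hj
  have : μ ^ n = μ ^ (n - 1 - j) * μ ^ (j + 1) := by rw [← pow_add]; congr 1; omega
  rw [this]
  field_simp

theorem tendsto_pow_succ_sub_pow_div (d : ℕ) :
    Tendsto (fun n : ℕ => (((n : ℝ) + 1) ^ (d + 1) - (n : ℝ) ^ (d + 1)) / (n : ℝ) ^ d) atTop
      (𝓝 (d + 1)) := by
  have h : Tendsto (fun n : ℕ => ∑ k ∈ Finset.range (d + 1), (((n : ℝ) + 1) / n) ^ k) atTop
      (𝓝 (∑ k ∈ Finset.range (d + 1), (1 : ℝ) ^ k)) :=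
    tendsto_finsetSum _ fun k _ => tendsto_succ_div_self.pow k
  simp only [one_pow, Finset.sum_const, Finset.card_range, nsmul_eq_mul, mul_one] at h
  push_cast at h
  refine h.congr' ?_
  filter_upwards [eventually_ge_atTop 1] with n hn
  have hn : (0 : ℝ) < n := by exact_mod_cast hn
  have := (Commute.all ((n : ℝ) + 1) (n : ℝ)).geom_sum₂_mul (d + 1)
  rw [add_sub_cancel_left, mul_one] at this
  rw [← this, Finset.sum_div]
  refine Finset.sum_congr rfl fun k hk => ?_
  have hk : k ≤ d := by simpa [Nat.lt_succ_iff] using hk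
  rw [div_pow, div_eq_div_iff (by positivity) (by positivity), mul_assoc, ← pow_add]
  congr 2
  omega

/-- Stolz–Cesàro: `G` is compared with the telescoping increments of `n ^ (d + 1)`, which are `~ (d
+ 1) * n ^ d`. -/
theorem tendsto_sum_div_pow {G : ℕ → ℝ} {d : ℕ} {κ : ℝ}
    (hG : Tendsto (fun n : ℕ => G n / (n : ℝ) ^ d) atTop (𝓝 κ)) :
    Tendsto (fun n : ℕ => (∑ i ∈ Finset.range n, G i) / (n : ℝ) ^ (d + 1)) atTop
      (𝓝 (κ / (d + 1))) := by
  set Δ : ℕ → ℝ := fun n => ((n : ℝ) + 1) ^ (d + 1) - (n : ℝ) ^ (d + 1) with hΔ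
  have hΔpos : ∀ n, 0 < Δ n := fun n => by
    simp only [hΔ, sub_pos]
    gcongr
    linarith
  have hsum : ∀ n, ∑ i ∈ Finset.range n, Δ i = (n : ℝ) ^ (d + 1) := fun n => by
    have := Finset.sum_range_sub (fun i : ℕ => (i : ℝ) ^ (d + 1)) n
    simpa [hΔ] using this
  have hd : (0 : ℝ) < d + 1 := by positivity
  have h1 : Tendsto (fun n : ℕ => (G n - κ / (d + 1) * Δ n) / Δ n) atTop (𝓝 0) := by
    have := (hG.div (tendsto_pow_succ_sub_pow_div d) hd.ne').sub_const (κ / (d + 1))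
    rw [sub_self] at this
    refine this.congr' ?_
    filter_upwards [eventually_ge_atTop 1] with n hn
    have hn : (0 : ℝ) < n := by exact_mod_cast hn
    have := hΔpos n
    simp only [Pi.div_apply]
    rw [div_div_div_cancel_right₀ (by positivity), sub_div, mul_div_cancel_right₀ _ this.ne']
  have h2 : (fun n : ℕ => G n - κ / (d + 1) * Δ n) =o[atTop] Δ :=
    (isLittleO_iff_tendsto fun n hn => absurd hn (hΔpos n).ne').2 h1
  have h3 := h2.sum_range (fun n => (hΔpos n).le) (by
    simp only [hsum]
    exact (tendsto_pow_atTop (by omega)).comp tendsto_natCast_atTop_atTop)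
  simp only [hsum, Finset.sum_sub_distrib, ← Finset.mul_sum] at h3
  have h4 := h3.tendsto_div_nhds_zero.add_const (κ / (d + 1))
  rw [zero_add] at h4
  refine h4.congr' ?_
  filter_upwards [eventually_ge_atTop 1] with n hn
  have hn : (0 : ℝ) < n := by exact_mod_cast hn
  field_simp
  ring

/-- Convolution of a geometric sequence with one of the same base. -/
theorem ExpPolyLim.conv_of_eq {u g : ℕ → ℝ} {d : ℕ} {θ κ ρ : ℝ} (hθ : 0 < θ)
    (hu : ExpPolyLim u 0 θ ρ) (hg : ExpPolyLim g d θ κ) :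
    ExpPolyLim (fun n => ∑ i ∈ Finset.range n, u (n - 1 - i) * g i) (d + 1) θ
      (ρ * (κ / (d + 1)) / θ) := by
  obtain ⟨C, hC, h⟩ := hg.exists_le_succ hθ
  set G : ℕ → ℝ := fun i => g i / θ ^ i with hGdef
  set U : ℕ → ℝ := fun i => u i / θ ^ i with hUdef
  have hU : Tendsto U atTop (𝓝 ρ) := by simpa [ExpPolyLim] using hu
  have hG : Tendsto (fun n : ℕ => G n / (n : ℝ) ^ d) atTop (𝓝 κ) := by
    refine Tendsto.congr (fun n => ?_) hg
    simp only [hGdef]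
    rw [div_div, mul_comm]
  have hGle : ∀ i, |G i| ≤ C * ((i : ℝ) + 1) ^ d := fun i => by
    simp only [hGdef]
    rw [abs_div, abs_of_pos (a := θ ^ i) (by positivity), div_le_iff₀ (by positivity), mul_assoc]
    exact h i
  have h1 := (tendsto_sum_div_pow hG).const_mul ρ
  have h2 : Tendsto (fun n : ℕ => (n : ℝ)⁻¹ * ∑ j ∈ Finset.range n, |U j - ρ|) atTop (𝓝 0) :=
    Tendsto.cesaro (by simpa using (hU.sub_const ρ).abs)
  -- Replacing `U (n - 1 - i)` by its limit `ρ` costs at most `C` times a Cesàro mean of `|U j -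
  -- ρ|`.
  have h3 : Tendsto (fun n : ℕ => (∑ i ∈ Finset.range n, (U (n - 1 - i) - ρ) * G i) /
      (n : ℝ) ^ (d + 1)) atTop (𝓝 0) := by
    refine squeeze_zero_norm' ?_ (by simpa using h2.const_mul C)
    filter_upwards [eventually_ge_atTop 1] with n hn
    have hn : (0 : ℝ) < n := by exact_mod_cast hn
    rw [norm_div, Real.norm_of_nonneg (r := (n : ℝ) ^ (d + 1)) (by positivity),
      div_le_iff₀ (by positivity)]
    refine (norm_sum_le _ _).trans ?_
    rw [← Finset.sum_range_reflect (fun j => |U j - ρ|)]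
    calc ∑ i ∈ Finset.range n, ‖(U (n - 1 - i) - ρ) * G i‖
        ≤ ∑ i ∈ Finset.range n, |U (n - 1 - i) - ρ| * (C * (n : ℝ) ^ d) := by
          refine Finset.sum_le_sum fun i hi => ?_
          have hi : i < n := by simpa using hi
          rw [Real.norm_eq_abs, abs_mul]
          gcongr
          refine (hGle i).trans ?_
          gcongr
          exact_mod_cast hi
      _ = _ := by
          rw [← Finset.sum_mul, pow_succ]
          field_simp
  have h4 := (h1.add h3).div_const θ
  rw [add_zero] at h4
  refine h4.congr' ?_
  filter_upwards [eventually_ge_atTop 1] with n hn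
  have hn : (0 : ℝ) < n := by exact_mod_cast hn
  have h5 : ∑ i ∈ Finset.range n, u (n - 1 - i) * g i =
      θ ^ n / θ * ∑ i ∈ Finset.range n, U (n - 1 - i) * G i := by
    rw [Finset.mul_sum]
    refine Finset.sum_congr rfl fun i hi => ?_
    have hi : i < n := by simpa using hi
    have : θ ^ n = θ ^ (n - 1 - i) * θ ^ i * θ := by
      rw [← pow_add, ← pow_succ]; congr 1; omega
    simp only [hUdef, hGdef, this]
    field_simp
  rw [h5]
  simp only [sub_mul, Finset.sum_sub_distrib, ← Finset.mul_sum]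
  field_simp
  ring

theorem tsum_div_pow_pos {g : ℕ → ℝ} {d : ℕ} {θ κ μ : ℝ} (hθ : 0 < θ) (hμ : θ < μ) (hκ : 0 < κ)
    (hg0 : ∀ n, 0 ≤ g n) (hg : ExpPolyLim g d θ κ) : 0 < ∑' n : ℕ, g n / μ ^ (n + 1) := by
  have hμ0 : 0 < μ := hθ.trans hμ
  obtain ⟨n, hn, hn1⟩ := ((hg.eventually (lt_mem_nhds hκ)).and (eventually_ge_atTop 1)).exists
  have hs : Summable fun n : ℕ => g n / μ ^ (n + 1) :=
    (summable_abs_iff.1 (summable_abs_div_pow hθ hμ hg))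
  refine hs.tsum_pos (fun n => by have := hg0 n; positivity) n ?_
  have : 0 < g n := by
    have := mul_pos hn (scale_pos (d := d) hθ hn1)
    rwa [div_mul_cancel₀ _ (scale_pos (d := d) hθ hn1).ne'] at this
  positivity

theorem HasExpPolyLim.conv {u g : ℕ → ℝ} {μ ρ : ℝ} (hμ : 0 < μ) (hρ : 0 < ρ)
    (hu0 : ∀ n, 0 ≤ u n) (hg0 : ∀ n, 0 ≤ g n)
    (hu : ExpPolyLim u 0 μ ρ) (hg : HasExpPolyLim g) :
    HasExpPolyLim (fun n => ∑ i ∈ Finset.range n, u (n - 1 - i) * g i) := by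
  rcases hg with rfl | ⟨d, θ, κ, hθ, hκ, hg⟩
  · left; ext; simp
  right
  rcases lt_trichotomy μ θ with h | rfl | h
  · exact ⟨d, θ, _, hθ, mul_pos (tsum_div_pow_pos hμ h hρ hu0 hu) hκ, hu.conv_of_lt hμ h hg⟩
  · exact ⟨d + 1, μ, _, hθ, by positivity, hu.conv_of_eq hθ hg⟩
  · exact ⟨0, μ, _, hμ, mul_pos (tsum_div_pow_pos hθ h hκ hg0 hg) hρ, hu.conv_of_gt hθ h hg⟩

end Subst

/-! ### Perron–Frobenius theory for positive matrices, by averaging. -/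

namespace Subst

open Topology Matrix

/-- Iterated averages with weights bounded below converge to a common limit. -/
theorem exists_tendsto_of_averaging {P : Type*} [Fintype P] [Nonempty P] {R : ℕ → P → ℝ}
    {w : ℕ → P → P → ℝ} {ε : ℝ} (hε : 0 < ε) (hw : ∀ n b c, ε ≤ w n b c)
    (hw1 : ∀ n b, ∑ c, w n b c = 1) (hR : ∀ n b, R (n + 1) b = ∑ c, w n b c * R n c) :
    ∃ L, (∀ b, Tendsto (fun n => R n b) atTop (𝓝 L)) ∧ ∃ b, R 0 b ≤ L := by
  set m : ℕ → ℝ := fun n => Finset.univ.inf' Finset.univ_nonempty (R n) with hm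
  set M : ℕ → ℝ := fun n => Finset.univ.sup' Finset.univ_nonempty (R n) with hM
  have hmle : ∀ n b, m n ≤ R n b := fun n b => Finset.inf'_le _ (Finset.mem_univ b)
  have hleM : ∀ n b, R n b ≤ M n := fun n b => Finset.le_sup' _ (Finset.mem_univ b)
  have hmM : ∀ n, m n ≤ M n := fun n => (hmle n (Classical.arbitrary P)).trans (hleM n _)
  have hmmono : Monotone m := monotone_nat_of_le_succ fun n =>
    Finset.le_inf' _ _ fun b _ => by
      rw [hR, ← one_mul (m n), ← hw1 n b, Finset.sum_mul]
      exact Finset.sum_le_sum fun c _ =>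
        mul_le_mul_of_nonneg_left (hmle n c) (hε.le.trans (hw n b c))
  -- Each average puts weight at least `ε` on the minimum, so the oscillation shrinks by a factor `1
  -- - ε`.
  have hMle : ∀ n, M (n + 1) ≤ M n - ε * (M n - m n) := fun n =>
    Finset.sup'_le _ _ fun b _ => by
      obtain ⟨c₀, -, hc₀⟩ := Finset.exists_mem_eq_inf' Finset.univ_nonempty (R n)
      have h1 : M n - R (n + 1) b = ∑ c, w n b c * (M n - R n c) := by
        simp only [mul_sub, Finset.sum_sub_distrib, ← Finset.sum_mul, hw1, hR, one_mul]
      have h2 : w n b c₀ * (M n - R n c₀) ≤ ∑ c, w n b c * (M n - R n c) :=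
        Finset.single_le_sum (f := fun c => w n b c * (M n - R n c)) (fun c _ =>
          mul_nonneg (hε.le.trans (hw n b c)) (sub_nonneg.2 (hleM n c))) (Finset.mem_univ c₀)
      have h3 : ε * (M n - m n) ≤ w n b c₀ * (M n - R n c₀) := by
        rw [show m n = R n c₀ from hc₀]
        exact mul_le_mul_of_nonneg_right (hw n b c₀) (sub_nonneg.2 (hleM n c₀))
      linarith
  have hε1 : ε ≤ 1 := by
    obtain ⟨b⟩ := ‹Nonempty P›
    rw [← hw1 0 b]
    exact (hw 0 b b).trans (Finset.single_le_sum (f := fun c => w 0 b c)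
      (fun c _ => hε.le.trans (hw 0 b c)) (Finset.mem_univ b))
  have hosc : ∀ n, M n - m n ≤ (1 - ε) ^ n * (M 0 - m 0) := fun n => by
    induction n with
    | zero => simp
    | succ n ih =>
      have h1 := hMle n
      have h2 := hmmono (Nat.le_succ n)
      calc M (n + 1) - m (n + 1) ≤ (1 - ε) * (M n - m n) := by
            have : m n ≤ m (n + 1) := h2
            linarith
        _ ≤ (1 - ε) * ((1 - ε) ^ n * (M 0 - m 0)) :=
            mul_le_mul_of_nonneg_left ih (by linarith)
        _ = _ := by ring
  have hosc0 : Tendsto (fun n => M n - m n) atTop (𝓝 0) := by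
    refine squeeze_zero (fun n => sub_nonneg.2 (hmM n)) hosc ?_
    simpa using (tendsto_pow_atTop_nhds_zero_of_lt_one (by linarith : 0 ≤ 1 - ε)
      (by linarith)).mul_const (M 0 - m 0)
  have hManti : Antitone M := antitone_nat_of_succ_le fun n =>
    (hMle n).trans (sub_le_self _ (mul_nonneg hε.le (sub_nonneg.2 (hmM n))))
  have hbdd : BddAbove (Set.range m) := ⟨M 0, by
    rintro _ ⟨n, rfl⟩
    exact (hmM n).trans (hManti (Nat.zero_le n))⟩
  have hlim := tendsto_atTop_ciSup hmmono hbdd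
  refine ⟨⨆ n, m n, fun b => ?_, ?_⟩
  · refine tendsto_of_tendsto_of_tendsto_of_le_of_le hlim ?_ (fun n => hmle n b)
      (fun n => hleM n b)
    simpa using hosc0.add hlim
  · obtain ⟨c₀, -, hc₀⟩ := Finset.exists_mem_eq_inf' Finset.univ_nonempty (R 0)
    exact ⟨c₀, hc₀ ▸ le_ciSup hbdd 0⟩

/-- The ratios at time `n + 1` are averages of those at time `n`, with weights `Q b c * u n c / u (n
+ 1) b`, and `hQ` bounds these below. The second conclusion serves to show that `L` is positive. -/
theorem exists_tendsto_ratio {P : Type*} [Fintype P] [Nonempty P] {Q : Matrix P P ℝ}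
    {u v : ℕ → P → ℝ} {ε : ℝ} (hε : 0 < ε) (hu0 : ∀ n b, 0 < u n b)
    (hu : ∀ n, u (n + 1) = Q *ᵥ u n) (hv : ∀ n, v (n + 1) = Q *ᵥ v n)
    (hQ : ∀ n b c, ε * u (n + 1) b ≤ Q b c * u n c) :
    ∃ L, (∀ b, Tendsto (fun n => v n b / u n b) atTop (𝓝 L)) ∧ ∃ b, v 0 b / u 0 b ≤ L := by
  refine exists_tendsto_of_averaging (R := fun n b => v n b / u n b)
    (w := fun n b c => Q b c * u n c / u (n + 1) b) hε (fun n b c => ?_) (fun n b => ?_)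
    (fun n b => ?_)
  · rw [le_div_iff₀ (hu0 _ _)]
    exact hQ n b c
  · rw [← Finset.sum_div, div_eq_one_iff_eq (hu0 _ _).ne', hu]
    rfl
  · rw [hv, show (Q *ᵥ v n) b = ∑ c, Q b c * v n c from rfl, Finset.sum_div]
    refine Finset.sum_congr rfl fun c _ => ?_
    have := hu0 n c
    field_simp

theorem mulVec_pos {P : Type*} [Fintype P] {Q : Matrix P P ℝ} (hQ : ∀ b c, 0 < Q b c)
    {v : P → ℝ} (hv : ∀ c, 0 ≤ v c) {c₀ : P} (hc : 0 < v c₀) (b : P) : 0 < (Q *ᵥ v) b :=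
  Finset.sum_pos' (fun c _ => mul_nonneg (hQ b c).le (hv c))
    ⟨c₀, Finset.mem_univ _, mul_pos (hQ b c₀) hc⟩

theorem exists_tendsto_pow_ratio {P : Type*} [Fintype P] [DecidableEq P] [Nonempty P]
    {Q : Matrix P P ℝ} (hQ : ∀ b c, 0 < Q b c) (v : P → ℝ) :
    ∃ L, (∀ b, Tendsto (fun n => (Q ^ n *ᵥ v) b / (Q ^ n *ᵥ 1) b) atTop (𝓝 L)) ∧
      ∃ b, (Q *ᵥ v) b / (Q *ᵥ 1) b ≤ L := by
  have hpow : ∀ (n : ℕ) (v : P → ℝ), Q ^ (n + 1) *ᵥ v = Q *ᵥ (Q ^ n *ᵥ v) := fun n v => by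
    rw [pow_succ', Matrix.mulVec_mulVec]
  have hpos : ∀ n b, 0 < (Q ^ n *ᵥ (1 : P → ℝ)) b := fun n => by
    induction n with
    | zero => simp
    | succ n ih =>
      intro b
      rw [hpow]
      exact mulVec_pos hQ (fun c => (ih c).le) (ih b) b
  obtain ⟨⟨b₁, c₁⟩, h₁⟩ := Finite.exists_min fun p : P × P => Q p.1 p.2
  obtain ⟨⟨b₂, c₂⟩, h₂⟩ := Finite.exists_max fun p : P × P => Q p.1 p.2
  set q := Q b₁ c₁
  set q' := Q b₂ c₂
  have hq : 0 < q := hQ _ _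
  have hq' : 0 < q' := hQ _ _
  have hmin : ∀ b c, q ≤ Q b c := fun b c => h₁ (b, c)
  have hmax : ∀ b c, Q b c ≤ q' := fun b c => h₂ (b, c)
  have hcard : (0 : ℝ) < Fintype.card P := by exact_mod_cast Fintype.card_pos
  -- Starting from the first power keeps the entries of `u n` between `q * s` and `q' * s`, whence
  -- `ε`. It also makes the lower bound for `L` positive when `v` is nonnegative and nonzero.
  obtain ⟨L, hL, b, hb⟩ := exists_tendsto_ratio (Q := Q) (u := fun n => Q ^ (n + 1) *ᵥ 1)
    (v := fun n => Q ^ (n + 1) *ᵥ v) (ε := q ^ 2 / (Fintype.card P * q' ^ 2)) (by positivity)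
    (fun n => hpos _) (fun n => hpow _ _) (fun n => hpow _ _) (fun n b c => by
      set s := ∑ c, (Q ^ n *ᵥ (1 : P → ℝ)) c with hs
      have hup : ∀ c, (Q ^ (n + 1) *ᵥ (1 : P → ℝ)) c ≤ q' * s := fun c => by
        rw [hpow, hs, Finset.mul_sum]
        exact Finset.sum_le_sum fun d _ => mul_le_mul_of_nonneg_right (hmax _ _) (hpos _ _).le
      have hlow : q * s ≤ (Q ^ (n + 1) *ᵥ (1 : P → ℝ)) c := by
        rw [hpow, hs, Finset.mul_sum]
        exact Finset.sum_le_sum fun d _ => mul_le_mul_of_nonneg_right (hmin _ _) (hpos _ _).le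
      have hup2 : (Q ^ (n + 1 + 1) *ᵥ (1 : P → ℝ)) b ≤ Fintype.card P * (q' * (q' * s)) := by
        rw [hpow]
        calc ∑ c, Q b c * (Q ^ (n + 1) *ᵥ (1 : P → ℝ)) c ≤ ∑ _c : P, q' * (q' * s) :=
              Finset.sum_le_sum fun c _ => mul_le_mul (hmax _ _) (hup c) (hpos _ _).le hq'.le
          _ = _ := by simp
      calc _ ≤ q ^ 2 / (Fintype.card P * q' ^ 2) * (Fintype.card P * (q' * (q' * s))) :=
            mul_le_mul_of_nonneg_left hup2 (by positivity)
        _ = q * (q * s) := by field_simp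
        _ ≤ _ := mul_le_mul (hmin b c) hlow
            (mul_nonneg hq.le (Finset.sum_nonneg fun c _ => (hpos n c).le)) (hQ b c).le)
  refine ⟨L, fun b => (tendsto_add_atTop_iff_nat 1).1 (hL b), b, by simpa using hb⟩

/-- A matrix with positive entries has a positive eigenvector. -/
theorem exists_pos_eigenvector {P : Type*} [Fintype P] [DecidableEq P] [Nonempty P]
    {Q : Matrix P P ℝ} (hQ : ∀ b c, 0 < Q b c) :
    ∃ (θ : ℝ) (r : P → ℝ), 0 < θ ∧ (∀ b, 0 < r b) ∧ Q *ᵥ r = θ • r := by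
  -- The limits of `(Qᵀ ^ n *ᵥ v) b / (Qᵀ ^ n *ᵥ 1) b` define a positive functional `ℓ`, and a shift
  -- of `n` shows that `ℓ ∘ Qᵀ` is a multiple of `ℓ`. Its values on the unit vectors thus form an
  -- eigenvector of `Q`.
  have hQt : ∀ b c, 0 < Qᵀ b c := fun b c => hQ c b
  choose ℓ hℓ hℓ0 using fun v => exists_tendsto_pow_ratio hQt v
  obtain ⟨b⟩ := ‹Nonempty P›
  have hℓpos : ∀ v : P → ℝ, (∀ c, 0 ≤ v c) → ∀ c₀, 0 < v c₀ → 0 < ℓ v := fun v hv c₀ hc => by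
    obtain ⟨b, hb⟩ := hℓ0 v
    exact (div_pos (mulVec_pos hQt hv hc b)
      (mulVec_pos hQt (fun _ => zero_le_one) (c₀ := b) one_pos b)).trans_le hb
  have hsum : ∀ a, ∑ c, Q a c * ℓ (Pi.single c 1) = ℓ (Qᵀ *ᵥ Pi.single a 1) := fun a => by
    refine tendsto_nhds_unique (f := fun n => ∑ c, Q a c *
      ((Qᵀ ^ n *ᵥ Pi.single c 1) b / (Qᵀ ^ n *ᵥ 1) b)) (l := atTop)
      (tendsto_finsetSum _ fun c _ => (hℓ _ b).const_mul _) ((hℓ _ b).congr fun n => ?_)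
    simp only [Matrix.mulVec_single_one, Matrix.col_apply, ← mul_div_assoc, ← Finset.sum_div]
    congr 1
    simp [Matrix.mulVec, dotProduct, Matrix.transpose_apply, Matrix.col, mul_comm]
  have hmul : ∀ v, ℓ (Qᵀ *ᵥ v) = ℓ (Qᵀ *ᵥ 1) * ℓ v := fun v => by
    refine tendsto_nhds_unique (hℓ (Qᵀ *ᵥ v) b)
      (((hℓ (Qᵀ *ᵥ 1) b).mul ((tendsto_add_atTop_iff_nat 1).2 (hℓ v b))).congr fun n => ?_)
    have h1 : (Qᵀ ^ (n + 1) *ᵥ (1 : P → ℝ)) b ≠ 0 := by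
      have : ∀ n b, 0 < (Qᵀ ^ n *ᵥ (1 : P → ℝ)) b := fun n => by
        induction n with
        | zero => simp
        | succ n ih =>
          intro b
          rw [pow_succ', ← Matrix.mulVec_mulVec]
          exact mulVec_pos hQt (fun c => (ih c).le) (ih b) b
      exact (this _ _).ne'
    simp only [Matrix.mulVec_mulVec, ← pow_succ]
    rw [mul_comm, div_mul_div_cancel₀ h1]
  refine ⟨ℓ (Qᵀ *ᵥ 1), fun c => ℓ (Pi.single c 1), ?_, fun c => ?_, ?_⟩
  · exact hℓpos _ (fun c => (mulVec_pos hQt (fun _ => zero_le_one) (c₀ := b) one_pos c).le) b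
      (mulVec_pos hQt (fun _ => zero_le_one) (c₀ := b) one_pos b)
  · refine hℓpos _ (fun d => ?_) c (by simp)
    by_cases h : d = c <;> simp [h]
  · ext a
    exact (hsum a).trans (hmul _)

/-- The powers of a positive matrix grow like those of its Perron eigenvalue. -/
theorem exists_expPolyLim_pow {P : Type*} [Fintype P] [DecidableEq P] [Nonempty P]
    {Q : Matrix P P ℝ} (hQ : ∀ b c, 0 < Q b c) :
    ∃ θ, 0 < θ ∧ ∀ b c, ∃ ρ, 0 < ρ ∧ ExpPolyLim (fun n => (Q ^ n) b c) 0 θ ρ := by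
  obtain ⟨θ, r, hθ, hr, hQr⟩ := exists_pos_eigenvector hQ
  refine ⟨θ, hθ, fun b c => ?_⟩
  obtain ⟨p, hp⟩ := Finite.exists_min fun p : P × P => Q p.1 p.2 * r p.2 / (θ * r p.1)
  -- Against the exact orbit `θ ^ n • r` the weights do not depend on `n`, and `ε` is their minimum.
  -- The other orbit starts at `Q *ᵥ Pi.single c 1`, whose entries are all positive, so that `0 <
  -- L`.
  obtain ⟨L, hL, d, hd⟩ := exists_tendsto_ratio (Q := Q) (u := fun n => θ ^ n • r)
    (v := fun n => Q ^ n *ᵥ (Q *ᵥ Pi.single c 1)) (ε := Q p.1 p.2 * r p.2 / (θ * r p.1))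
    (div_pos (mul_pos (hQ _ _) (hr _)) (mul_pos hθ (hr _)))
    (fun n b => mul_pos (pow_pos hθ n) (hr b))
    (fun n => by rw [Matrix.mulVec_smul, hQr, smul_smul, pow_succ])
    (fun n => by rw [pow_succ', ← Matrix.mulVec_mulVec])
    (fun n b c => by
      have h1 := hp (b, c)
      have h2 := mul_pos hθ (hr b)
      rw [le_div_iff₀ h2] at h1
      have h3 := mul_le_mul_of_nonneg_left h1 (pow_pos hθ n).le
      simp only [Pi.smul_apply, smul_eq_mul]
      calc _ = θ ^ n * (Q p.1 p.2 * r p.2 / (θ * r p.1) * (θ * r b)) := by ring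
        _ ≤ _ := h3
        _ = _ := by ring)
  have hLpos : 0 < L := by
    refine lt_of_lt_of_le (div_pos ?_ ?_) hd
    · simpa using hQ d c
    · simpa using hr d
  refine ⟨L * r b / θ, div_pos (mul_pos hLpos (hr b)) hθ, ExpPolyLim.of_succ hθ ?_⟩
  refine ((hL b).mul_const (r b)).congr fun n => ?_
  have := hr b
  rw [Matrix.mulVec_mulVec, ← pow_succ, Matrix.mulVec_single_one]
  simp only [Matrix.col_apply, Pi.smul_apply, smul_eq_mul]
  field_simp

end Subst

/-! ### Nonnegative matrices with transitive support. -/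

namespace Subst

open Topology Matrix

theorem eq_pow_mulVec_add_sum {P : Type*} [Fintype P] [DecidableEq P] {Q : Matrix P P ℝ}
    {F G : ℕ → P → ℝ} (h : ∀ n, F (n + 1) = Q *ᵥ F n + G n) (n : ℕ) :
    F n = Q ^ n *ᵥ F 0 + ∑ i ∈ Finset.range n, Q ^ (n - 1 - i) *ᵥ G i := by
  induction n with
  | zero => simp
  | succ n ih =>
    rw [h, Finset.sum_range_succ]
    conv_lhs => rw [ih]
    rw [Matrix.mulVec_add, Matrix.mulVec_mulVec, ← pow_succ', add_assoc]
    congr 1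
    simp only [Nat.add_sub_cancel, Nat.sub_self, pow_zero, Matrix.one_mulVec]
    congr 1
    rw [Matrix.mulVec_sum]
    refine Finset.sum_congr rfl fun i hi => ?_
    have hi : i < n := by simpa using hi
    rw [Matrix.mulVec_mulVec, ← pow_succ']
    congr 2
    omega

/-- The orbit of a positive vector under a nonnegative matrix with transitive support
has an exponential-polynomial asymptotic in each coordinate. -/
theorem hasExpPolyLim_of_transitive {A : Type*} [Fintype A] {N : A → A → ℝ}
    (hN : ∀ a b, 0 ≤ N a b) (htrans : ∀ a b c, 0 < N a b → 0 < N b c → 0 < N a c)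
    {f : A → ℕ → ℝ} (hf0 : ∀ a n, 0 < f a n) (hf : ∀ a n, f a (n + 1) = ∑ b, N a b * f b n)
    (a : A) : HasExpPolyLim (f a) := by
  classical
  -- Induction on the number of letters reachable from `a`, itself included. It drops at every other
  -- reachable letter from which `a` cannot be reached.
  induction h : (Finset.univ.filter fun b => b = a ∨ 0 < N a b).card using Nat.strong_induction_on
    generalizing a with
  | _ k ih =>
  have lower : ∀ b, 0 < N a b → N b a = 0 → b ≠ a → HasExpPolyLim (f b) := fun b hab hba hne => by
    refine ih _ ?_ b rfl
    rw [← h]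
    refine Finset.card_lt_card (Finset.ssubset_iff_of_subset ?_ |>.2 ⟨a, by simp, ?_⟩)
    · intro c
      simp only [Finset.mem_filter, Finset.mem_univ, true_and]
      rintro (rfl | hc)
      · exact Or.inr hab
      · exact Or.inr (htrans _ _ _ hab hc)
    · simp [hba, hne.symm]
  rcases (hN a a).eq_or_lt with haa | haa
  · refine HasExpPolyLim.of_succ (Or.inr ⟨0, (hf0 _ _).ne'⟩) ?_
    simp only [hf]
    refine HasExpPolyLim.sum _ fun b _ => ?_
    rcases (hN a b).eq_or_lt with hab | hab
    · left; ext; simp [← hab]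
    · refine (lower b hab ?_ ?_).const_mul (hN a b)
      · by_contra hba
        exact (htrans _ _ _ hab (lt_of_le_of_ne (hN b a) (Ne.symm hba))).ne haa
      · rintro rfl
        exact hab.ne haa
  -- By transitivity the class of `a` carries a strictly positive matrix, so no period appears. The
  -- lower letters enter as a forcing term `G`, and variation of constants reduces to convolutions.
  · let P := {b // 0 < N a b ∧ 0 < N b a}
    let Q : Matrix P P ℝ := fun b c => N b c
    have hQ : ∀ b c, 0 < Q b c := fun b c => htrans _ _ _ b.2.2 c.2.1
    have : Nonempty P := ⟨⟨a, haa, haa⟩⟩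
    obtain ⟨θ, hθ, hρ⟩ := exists_expPolyLim_pow hQ
    have hQ0 : ∀ n b c, 0 ≤ (Q ^ n) b c := fun n => by
      induction n with
      | zero => intro b c; rw [pow_zero, Matrix.one_apply]; split_ifs <;> simp
      | succ n ih =>
        intro b c
        rw [pow_succ, Matrix.mul_apply]
        exact Finset.sum_nonneg fun d _ => mul_nonneg (ih _ _) (hQ _ _).le
    let G : ℕ → P → ℝ := fun n b => ∑ e : {e // ¬(0 < N a e ∧ 0 < N e a)}, N b e * f e n
    have hG0 : ∀ n b, 0 ≤ G n b := fun n b =>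
      Finset.sum_nonneg fun e _ => mul_nonneg (hN _ _) (hf0 _ _).le
    have hGlim : ∀ b, HasExpPolyLim (fun n => G n b) := fun b => by
      refine HasExpPolyLim.sum _ fun e _ => ?_
      rcases (hN b e).eq_or_lt with hbe | hbe
      · left; ext; simp [← hbe]
      · have hae := htrans _ _ _ b.2.1 hbe
        have hea : N e a = 0 := by
          by_contra hea
          exact e.2 ⟨hae, lt_of_le_of_ne (hN _ _) (Ne.symm hea)⟩
        refine (lower e hae hea ?_).const_mul (hN _ _)
        intro he
        rw [he] at hea
        exact haa.ne' hea
    have key := eq_pow_mulVec_add_sum (Q := Q) (F := fun n b => f b n) (G := G) (fun n => by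
      ext b
      rw [hf, ← Fintype.sum_subtype_add_sum_subtype (fun e => 0 < N a e ∧ 0 < N e a)]
      rfl)
    have hfa : f a = (fun n => ∑ c : P, f c 0 * (Q ^ n) ⟨a, haa, haa⟩ c) + fun n =>
        ∑ c : P, ∑ i ∈ Finset.range n, (Q ^ (n - 1 - i)) ⟨a, haa, haa⟩ c * G i c := by
      ext n
      have := congrFun (key n) ⟨a, haa, haa⟩
      simp only at this
      rw [this, Pi.add_apply, Pi.add_apply, Finset.sum_apply, Finset.sum_comm]
      congr 1
      exact Finset.sum_congr rfl fun c _ => mul_comm _ _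
    rw [hfa]
    refine HasExpPolyLim.add (HasExpPolyLim.sum _ fun c _ => ?_) (HasExpPolyLim.sum _ fun c _ => ?_)
    · obtain ⟨ρ, hρ0, hρ⟩ := hρ ⟨a, haa, haa⟩ c
      exact HasExpPolyLim.const_mul (Or.inr ⟨0, θ, ρ, hθ, hρ0, hρ⟩) (hf0 _ _).le
    · obtain ⟨ρ, hρ0, hρ⟩ := hρ ⟨a, haa, haa⟩ c
      exact HasExpPolyLim.conv hθ hρ0 (fun n => hQ0 _ _ _) (fun n => hG0 _ _) hρ (hGlim c)

end Subst

/-! ### Density of the ratios of two independent scales. -/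

namespace Subst

open Topology

theorem irrational_log_div_log {α β : ℝ} (hα : 1 < α) (hβ : 1 < β) (h : MulIndep α β) :
    Irrational (Real.log α / Real.log β) := by
  rintro ⟨q, hq⟩
  have ha := Real.log_pos hα
  have hb := Real.log_pos hβ
  have hq0 : 0 < q := by
    have : (0 : ℝ) < q := hq ▸ div_pos ha hb
    exact_mod_cast this
  have hnum : 0 < q.num := Rat.num_pos.2 hq0
  obtain ⟨k, hk⟩ := Int.eq_ofNat_of_zero_le hnum.le
  have hk0 : 0 < k := by omega
  refine h q.den k q.den_pos hk0 ?_
  refine Real.log_injOn_pos (pow_pos (zero_lt_one.trans hα) _) (pow_pos (zero_lt_one.trans hβ) _) ?_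
  rw [Real.log_pow, Real.log_pow]
  have h1 : (q : ℝ) = k / q.den := by
    rw [Rat.cast_def, hk]; simp
  have h2 : (0 : ℝ) < q.den := by exact_mod_cast q.den_pos
  rw [h1, div_eq_div_iff h2.ne' hb.ne'] at hq
  linarith

theorem exists_nat_combination {a b : ℝ} (ha : 0 < a) (hb : 0 < b) (h : Irrational (a / b))
    {ε : ℝ} (hε : 0 < ε) :
    ∃ p q : ℕ, 0 < p ∧ 0 < q ∧ 0 < p * b - q * a ∧ p * b - q * a < ε := by
  have hne : ∀ p q : ℕ, 0 < q → (p : ℝ) * b - q * a ≠ 0 := fun p q hq h0 => by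
    refine h ⟨p / q, ?_⟩
    have : (0 : ℝ) < q := by exact_mod_cast hq
    push_cast
    rw [div_eq_div_iff this.ne' hb.ne']
    linarith
  have hd : Dense (AddSubgroup.closure {a, b} : Set ℝ) := dense_addSubgroupClosure_pair_iff.2 h
  -- A positive combination smaller than both `a` and `b` must have coefficients of opposite signs.
  set η := min ε (min a b) with hη
  have hη0 : 0 < η := by positivity
  obtain ⟨t, ht, ht0, htη⟩ := hd.exists_between hη0
  obtain ⟨i, j, hij⟩ := AddSubgroup.mem_closure_pair.1 ht
  simp only [zsmul_eq_mul] at hij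
  have hta : t < a := htη.trans_le ((min_le_right _ _).trans (min_le_left _ _))
  have htb : t < b := htη.trans_le ((min_le_right _ _).trans (min_le_right _ _))
  have htε : t < ε := htη.trans_le (min_le_left _ _)
  have cast_le : ∀ {z : ℤ}, 1 ≤ z → (1 : ℝ) ≤ z := fun h => by exact_mod_cast h
  have cast_le' : ∀ {z : ℤ}, z ≤ 0 → (z : ℝ) ≤ 0 := fun h => by exact_mod_cast h
  rcases le_or_gt j 0 with hj | hj
  · have hi : 1 ≤ i := by
      by_contra hi
      have := cast_le' (z := i) (by omega)
      have := cast_le' hj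
      nlinarith
    have hj : j ≤ -1 := by
      by_contra hj'
      have : j = 0 := by omega
      subst this
      have := cast_le hi
      push_cast at hij
      nlinarith
    obtain ⟨p, rfl⟩ := Int.eq_ofNat_of_zero_le (by omega : 0 ≤ i)
    obtain ⟨q, hq⟩ := Int.eq_ofNat_of_zero_le (by omega : 0 ≤ -j)
    obtain rfl : j = -(q : ℤ) := by omega
    push_cast at hij
    have hij' : (q : ℝ) * b - p * a = -t := by linarith
    -- Here the signs are the wrong way round. The remainder `b - k * t` has the right ones, is less
    -- than `t`, and is nonzero by irrationality.
    set k := ⌊b / t⌋₊ with hk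
    have hk1 : (k : ℝ) * t ≤ b := by
      rw [← le_div_iff₀ ht0]; exact Nat.floor_le (by positivity)
    have hk2 : b < (k + 1) * t := by
      rw [← div_lt_iff₀ ht0]; exact Nat.lt_floor_add_one _
    have hk0 : 0 < k := Nat.floor_pos.2 ((one_le_div ht0).2 htb.le)
    have hp : 0 < p := by omega
    have e : ((1 + k * q : ℕ) : ℝ) * b - ((k * p : ℕ) : ℝ) * a = b - k * t := by
      push_cast
      linear_combination (k : ℝ) * hij'
    refine ⟨1 + k * q, k * p, by omega, by positivity, ?_, ?_⟩
    · refine lt_of_le_of_ne ?_ (hne _ _ (by positivity)).symm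
      rw [e]; linarith
    · rw [e]; linarith
  · have hi : i ≤ -1 := by
      by_contra hi
      rcases (by omega : i = 0 ∨ 1 ≤ i) with rfl | hi
      · have := cast_le (z := j) (by omega)
        push_cast at hij
        nlinarith
      · have := cast_le hi
        have := cast_le (z := j) (by omega)
        nlinarith
    obtain ⟨q, hq⟩ := Int.eq_ofNat_of_zero_le (by omega : 0 ≤ -i)
    obtain ⟨p, rfl⟩ := Int.eq_ofNat_of_zero_le (by omega : 0 ≤ j)
    obtain rfl : i = -(q : ℤ) := by omega
    push_cast at hij
    exact ⟨p, q, by omega, by omega, by linarith, by linarith⟩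

theorem tendsto_sub_of_tendsto_succ_sub {U : ℕ → ℝ} {b : ℝ}
    (hU : Tendsto (fun n => U (n + 1) - U n) atTop (𝓝 b)) (p : ℕ) :
    Tendsto (fun n => U (n + p) - U n) atTop (𝓝 (p * b)) := by
  induction p with
  | zero => simp
  | succ p ih =>
    have := ((tendsto_add_atTop_iff_nat p).2 hU).add ih
    push_cast
    rw [add_mul, one_mul, add_comm ((p : ℝ) * b)]
    refine this.congr fun n => ?_
    rw [add_assoc n p 1]
    ring

/-- Differences of two sequences with incommensurable asymptotic steps are dense. -/
theorem exists_sub_mem_Ioo {U V : ℕ → ℝ} {a b : ℝ} (ha : 0 < a) (hb : 0 < b)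
    (hab : Irrational (a / b)) (hU : Tendsto (fun n => U (n + 1) - U n) atTop (𝓝 b))
    (hV : Tendsto (fun n => V (n + 1) - V n) atTop (𝓝 a)) (hV' : Tendsto V atTop atTop)
    {s s' : ℝ} (hs : s < s') (M : ℕ) :
    ∃ n m, M ≤ n ∧ M ≤ m ∧ s < U m - V n ∧ U m - V n < s' := by
  obtain ⟨p, q, hp, hq, h0, h1⟩ := exists_nat_combination ha hb hab
    (show 0 < (s' - s) / 2 by linarith)
  set δ := p * b - q * a with hδ
  obtain ⟨M₁, hM₁⟩ := eventually_atTop.1 ((tendsto_sub_of_tendsto_succ_sub hU p).eventually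
    (Ioo_mem_nhds (show p * b - δ / 4 < p * b by linarith)
      (show p * b < p * b + δ / 4 by linarith)))
  obtain ⟨M₂, hM₂⟩ := eventually_atTop.1 ((tendsto_sub_of_tendsto_succ_sub hV q).eventually
    (Ioo_mem_nhds (show q * a - δ / 4 < q * a by linarith)
      (show q * a < q * a + δ / 4 by linarith)))
  set m₀ := max M M₁
  obtain ⟨n₀, hn₀, hn₀'⟩ := ((hV'.eventually_gt_atTop (U m₀ - s)).and
    (eventually_ge_atTop (max M M₂))).exists
  -- The sequence `w` starts below `s` and rises by steps between `δ / 2` and `3 * δ / 2 < s' - s`,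
  -- so its first term above `s` is below `s'`.
  set w : ℕ → ℝ := fun i => U (m₀ + i * p) - V (n₀ + i * q) with hw
  have hstep : ∀ i, w i + δ / 2 ≤ w (i + 1) ∧ w (i + 1) ≤ w i + 3 * δ / 2 := fun i => by
    have e1 := hM₁ (m₀ + i * p) ((le_max_right _ _).trans (Nat.le_add_right _ _))
    have e2 := hM₂ (n₀ + i * q) (((le_max_right _ _).trans hn₀').trans (Nat.le_add_right _ _))
    simp only [hw, add_mul, one_mul, ← add_assoc]
    constructor <;> linarith [e1.1, e1.2, e2.1, e2.2]
  have hlow : ∀ i : ℕ, w 0 + i * (δ / 2) ≤ w i := fun i => by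
    induction i with
    | zero => simp
    | succ i ih => push_cast; linarith [(hstep i).1]
  have hex : ∃ i, s < w i := by
    obtain ⟨i, hi⟩ := exists_nat_gt ((s - w 0) / (δ / 2))
    refine ⟨i, ?_⟩
    rw [div_lt_iff₀ (by linarith)] at hi
    linarith [hlow i]
  classical
  have hfind := Nat.find_spec hex
  have hpos : Nat.find hex ≠ 0 := fun h => by
    rw [h] at hfind
    simp only [hw, zero_mul, add_zero] at hfind
    linarith
  obtain ⟨i, hi⟩ := Nat.exists_eq_succ_of_ne_zero hpos
  have hprev := Nat.find_min hex (m := i) (by omega)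
  rw [hi] at hfind
  refine ⟨n₀ + (i + 1) * q, m₀ + (i + 1) * p,
    ((le_max_left _ _).trans hn₀').trans (Nat.le_add_right _ _),
    (le_max_left _ _).trans (Nat.le_add_right _ _), hfind, ?_⟩
  have := (hstep i).2
  change w (i + 1) < s'
  linarith

theorem tendsto_log_scale_succ_sub (d : ℕ) {θ : ℝ} (hθ : 0 < θ) :
    Tendsto (fun n : ℕ => Real.log (((n + 1 : ℕ) : ℝ) ^ d * θ ^ (n + 1)) -
      Real.log ((n : ℝ) ^ d * θ ^ n)) atTop (𝓝 (Real.log θ)) := by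
  refine ((Real.continuousAt_log hθ.ne').tendsto.comp (tendsto_scale_succ d hθ)).congr' ?_
  filter_upwards [eventually_ge_atTop 1] with n hn
  exact Real.log_div (scale_pos hθ (by omega)).ne' (scale_pos hθ hn).ne'

theorem tendsto_log_scale_atTop (d : ℕ) {θ : ℝ} (hθ : 1 < θ) :
    Tendsto (fun n : ℕ => Real.log ((n : ℝ) ^ d * θ ^ n)) atTop atTop := by
  refine Real.tendsto_log_atTop.comp
    (tendsto_atTop_mono' _ ?_ (tendsto_pow_atTop_atTop_of_one_lt hθ))
  filter_upwards [eventually_ge_atTop 1] with n hn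
  exact le_mul_of_one_le_left (pow_nonneg (by linarith) _) (one_le_pow₀ (by exact_mod_cast hn))

/-- The ratios of two multiplicatively independent scales are dense in the positive reals. -/
theorem exists_scale_between {α β : ℝ} (hα : 1 < α) (hβ : 1 < β) (h : MulIndep α β) (d e : ℕ)
    {r r' : ℝ} (hr : 0 < r) (hr' : r < r') (M : ℕ) :
    ∃ n m : ℕ, M ≤ n ∧ M ≤ m ∧ r * ((n : ℝ) ^ d * α ^ n) < (m : ℝ) ^ e * β ^ m ∧
      (m : ℝ) ^ e * β ^ m < r' * ((n : ℝ) ^ d * α ^ n) := by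
  obtain ⟨n, m, hn, hm, h1, h2⟩ := exists_sub_mem_Ioo
    (U := fun m : ℕ => Real.log ((m : ℝ) ^ e * β ^ m))
    (V := fun n : ℕ => Real.log ((n : ℝ) ^ d * α ^ n)) (Real.log_pos hα) (Real.log_pos hβ)
    (irrational_log_div_log hα hβ h) (tendsto_log_scale_succ_sub e (zero_lt_one.trans hβ))
    (tendsto_log_scale_succ_sub d (zero_lt_one.trans hα)) (tendsto_log_scale_atTop d hα)
    (Real.log_lt_log hr hr') (max M 1)
  have hn1 := scale_pos (d := d) (show 0 < α by linarith) ((le_max_right _ _).trans hn)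
  have hm1 := scale_pos (d := e) (show 0 < β by linarith) ((le_max_right _ _).trans hm)
  refine ⟨n, m, (le_max_left _ _).trans hn, (le_max_left _ _).trans hm, ?_, ?_⟩
  · rw [← Real.log_lt_log_iff (by positivity) hm1, Real.log_mul hr.ne' hn1.ne']
    linarith
  · rw [← Real.log_lt_log_iff hm1 (mul_pos (hr.trans hr') hn1),
      Real.log_mul (hr.trans hr').ne' hn1.ne']
    linarith

end Subst

/-! ### Block maps and their idempotent powers. -/

namespace Subst

open Topology

/-- `g` cuts `ℕ` into consecutive nonempty blocks `[g j, g (j + 1))`, and the word that `y` spells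
on the block of `j` depends only on the letter `y j`. -/
structure IsBlockMap {A : Type*} (y : ℕ → A) (g : ℕ → ℕ) : Prop where
  map_zero : g 0 = 0
  strictMono : StrictMono g
  length_eq : ∀ i j, y i = y j → g (i + 1) + g j = g (j + 1) + g i
  apply_eq : ∀ i j t, y i = y j → g i + t < g (i + 1) → y (g i + t) = y (g j + t)

/-- The letter `b` occurs in the block of the letter `a`. -/
def Occ {A : Type*} (y : ℕ → A) (g : ℕ → ℕ) (a b : A) : Prop :=
  ∃ i t, y i = a ∧ g i ≤ t ∧ t < g (i + 1) ∧ y t = b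

namespace IsBlockMap

variable {A : Type*} {y : ℕ → A} {g h : ℕ → ℕ}

theorem exists_block (hg : IsBlockMap y g) (t : ℕ) : ∃ j, g j ≤ t ∧ t < g (j + 1) := by
  induction t with
  | zero => exact ⟨0, hg.map_zero.le, (hg.strictMono (Nat.lt_add_one 0)).trans_le' (by omega)⟩
  | succ t ih =>
    obtain ⟨j, h1, h2⟩ := ih
    rcases (show t + 1 < g (j + 1) ∨ t + 1 = g (j + 1) by omega) with h | h
    · exact ⟨j, by omega, h⟩
    · exact ⟨j + 1, h.ge, h ▸ hg.strictMono (Nat.lt_add_one _)⟩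

theorem word_length_eq (hg : IsBlockMap y g) {i j l : ℕ} (hw : ∀ t < l, y (i + t) = y (j + t)) :
    ∀ t ≤ l, g (i + t) + g j = g (j + t) + g i := by
  intro t ht
  induction t with
  | zero => simp [add_comm]
  | succ t ih =>
    have h1 := ih (by omega)
    have h2 := hg.length_eq _ _ (hw t (by omega))
    rw [← add_assoc, ← add_assoc]
    omega

/-- The position lies in the block of a single letter of the word, and the cuts before it agree by
`word_length_eq`. This is what lets block maps compose. -/
theorem word_apply_eq (hg : IsBlockMap y g) {i j l : ℕ} (hw : ∀ t < l, y (i + t) = y (j + t))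
    {s : ℕ} (hs : g i + s < g (i + l)) : y (g i + s) = y (g j + s) := by
  obtain ⟨k, hk1, hk2⟩ := hg.exists_block (g i + s)
  have hik : i ≤ k := by
    by_contra hik
    have := hg.strictMono.monotone (show k + 1 ≤ i by omega)
    omega
  have hkl : k < i + l := by
    by_contra hkl
    have := hg.strictMono.monotone (show i + l ≤ k by omega)
    omega
  obtain ⟨t, rfl⟩ := Nat.exists_eq_add_of_le hik
  have h1 := hg.word_length_eq hw t (by omega)
  obtain ⟨u, hu⟩ := Nat.exists_eq_add_of_le hk1
  have h2 := hg.apply_eq (i + t) (j + t) u (hw t (by omega)) (by omega)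
  rw [← hu] at h2
  rw [h2]
  congr 1
  omega

theorem id (y : ℕ → A) : IsBlockMap y id where
  map_zero := rfl
  strictMono := strictMono_id
  length_eq i j _ := by simp only [id_eq]; omega
  apply_eq i j t hij ht := by
    obtain rfl : t = 0 := by simp only [id_eq] at ht; omega
    exact hij

theorem comp (hg : IsBlockMap y g) (hh : IsBlockMap y h) : IsBlockMap y (g ∘ h) := by
  have hw : ∀ i j, y i = y j → ∀ t < h (i + 1) - h i, y (h i + t) = y (h j + t) :=
    fun i j hij t ht => hh.apply_eq i j t hij (by omega)
  refine ⟨by simp [hg.map_zero, hh.map_zero], hg.strictMono.comp hh.strictMono,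
    fun i j hij => ?_, fun i j t hij ht => ?_⟩
  · have h1 := hg.word_length_eq (hw i j hij) _ le_rfl
    have h2 := hh.length_eq i j hij
    have h3 := hh.strictMono (Nat.lt_add_one i)
    have h4 := hh.strictMono (Nat.lt_add_one j)
    simp only [Function.comp]
    rwa [show h i + (h (i + 1) - h i) = h (i + 1) by omega,
      show h j + (h (i + 1) - h i) = h (j + 1) by omega] at h1
  · have h3 := hh.strictMono (Nat.lt_add_one i)
    refine hg.word_apply_eq (hw i j hij) ?_
    rwa [show h i + (h (i + 1) - h i) = h (i + 1) by omega]

theorem iterate (hg : IsBlockMap y g) (n : ℕ) : IsBlockMap y g^[n] := by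
  induction n with
  | zero => exact id y
  | succ n ih => exact ih.comp hg

theorem exists_occ (hg : IsBlockMap y g) {a b : A} (hab : Occ y g a b) {i : ℕ} (hi : y i = a) :
    ∃ t, g i ≤ t ∧ t < g (i + 1) ∧ y t = b := by
  obtain ⟨j, t, rfl, h1, h2, rfl⟩ := hab
  obtain ⟨s, rfl⟩ := Nat.exists_eq_add_of_le h1
  have := hg.length_eq _ _ hi
  exact ⟨g i + s, by omega, by omega, (hg.apply_eq _ _ _ hi (by omega))⟩

theorem occ_comp (hg : IsBlockMap y g) (a b : A) :
    Occ y (g ∘ h) a b ↔ ∃ c, Occ y h a c ∧ Occ y g c b := by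
  constructor
  · rintro ⟨i, t, hi, h1, h2, hb⟩
    obtain ⟨k, hk1, hk2⟩ := hg.exists_block t
    refine ⟨y k, ⟨i, k, hi, ?_, ?_, rfl⟩, ⟨k, t, rfl, hk1, hk2, hb⟩⟩
    · by_contra hlt
      have := hg.strictMono.monotone (show k + 1 ≤ h i by omega)
      simp only [Function.comp] at h1
      omega
    · by_contra hlt
      have := hg.strictMono.monotone (show h (i + 1) ≤ k by omega)
      simp only [Function.comp] at h2
      omega
  · rintro ⟨c, ⟨i, k, hi, hk1, hk2, hc⟩, hcb⟩
    obtain ⟨t, ht1, ht2, hb⟩ := hg.exists_occ hcb hc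
    exact ⟨i, t, hi, (hg.strictMono.monotone hk1).trans ht1,
      ht2.trans_le (hg.strictMono.monotone hk2), hb⟩

theorem occ_iterate_add (hg : IsBlockMap y g) (m n : ℕ) (a b : A) :
    Occ y g^[m + n] a b ↔ ∃ c, Occ y g^[n] a c ∧ Occ y g^[m] c b := by
  rw [Function.iterate_add]
  exact (hg.iterate m).occ_comp a b

end IsBlockMap

/-- A block map whose occurrence relation is idempotent and whose blocks have length at least 2. -/
structure IsIdempotentBlockMap {A : Type*} (y : ℕ → A) (g : ℕ → ℕ) : Prop
    extends IsBlockMap y g where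
  two_le : ∀ j, g j + 2 ≤ g (j + 1)
  occ_iterate : ∀ n a b, Occ y g^[n + 1] a b ↔ Occ y g a b

/-- Relations on a finite alphabet form a finite monoid, so the powers of `Occ y g` are eventually
periodic. A multiple of the period beyond the preperiod gives an idempotent, and it can be taken
large enough to make all blocks long. -/
theorem IsBlockMap.exists_iterate_isIdempotentBlockMap {A : Type*} [Finite A] {y : ℕ → A}
    {g : ℕ → ℕ} (hg : IsBlockMap y g)
    (hgrow : ∀ j, Tendsto (fun n => g^[n] (j + 1) - g^[n] j) atTop atTop) :
    ∃ p, 0 < p ∧ IsIdempotentBlockMap y g^[p] := by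
  have hlen : ∃ n₀, ∀ n ≥ n₀, ∀ j, g^[n] j + 2 ≤ g^[n] (j + 1) := by
    have : ∀ a : A, ∃ n₀, ∀ n ≥ n₀, ∀ j, y j = a → g^[n] j + 2 ≤ g^[n] (j + 1) := fun a => by
      by_cases h : ∃ j, y j = a
      · obtain ⟨j, hj⟩ := h
        obtain ⟨n₀, hn₀⟩ := eventually_atTop.1 ((hgrow j).eventually_ge_atTop 2)
        refine ⟨n₀, fun n hn i hi => ?_⟩
        have h1 := hn₀ n hn
        have h2 := (hg.iterate n).length_eq i j (hi.trans hj.symm)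
        have h3 := (hg.iterate n).strictMono (Nat.lt_add_one j)
        omega
      · exact ⟨0, fun n _ j hj => absurd ⟨j, hj⟩ h⟩
    choose n₀ hn₀ using this
    obtain ⟨N, hN⟩ := (Set.finite_range n₀).bddAbove
    exact ⟨N, fun n hn j => hn₀ (y j) n ((hN ⟨_, rfl⟩).trans hn) j rfl⟩
  obtain ⟨n₀, hn₀⟩ := hlen
  obtain ⟨i, j, hij, hE⟩ := Finite.exists_ne_map_eq_of_infinite fun n => Occ y g^[n]
  wlog hlt : i < j generalizing i j
  · exact this j i hij.symm hE.symm (by omega)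
  obtain ⟨k, rfl⟩ := Nat.exists_eq_add_of_lt hlt
  have hper : ∀ n ≥ i, Occ y g^[n + (k + 1)] = Occ y g^[n] := fun n hn => by
    obtain ⟨m, rfl⟩ := Nat.exists_eq_add_of_le hn
    ext a b
    rw [show i + m + (k + 1) = m + (i + k + 1) by omega, show i + m = m + i by omega,
      hg.occ_iterate_add, hg.occ_iterate_add]
    simp only [hE]
  have hper' : ∀ c, ∀ n ≥ i, Occ y g^[n + (k + 1) * c] = Occ y g^[n] := fun c => by
    induction c with
    | zero => simp
    | succ c ih =>
      intro n hn
      rw [mul_add, mul_one, ← add_assoc, hper _ (by omega), ih n hn]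
  refine ⟨(k + 1) * (i + n₀ + 1), by positivity, hg.iterate _, fun j => hn₀ _ ?_ j,
    fun n a b => ?_⟩
  · have := Nat.le_mul_of_pos_left (i + n₀ + 1) (show 0 < k + 1 by omega)
    omega
  · rw [← Function.iterate_mul]
    have h1 : (k + 1) * (i + n₀ + 1) * (n + 1) =
        (k + 1) * (i + n₀ + 1) + (k + 1) * ((i + n₀ + 1) * n) := by ring
    rw [h1, hper']
    have := Nat.le_mul_of_pos_left (i + n₀ + 1) (show 0 < k + 1 by omega)
    omega

end Subst

/-! ### Asymptotics of block lengths and cut points. -/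

namespace Subst

open Topology

/-- The length of the block of `j` at level `n`. -/
noncomputable def blockLen (g : ℕ → ℕ) (n j : ℕ) : ℝ := (g^[n] (j + 1) : ℝ) - g^[n] j

variable {A : Type*} {y : ℕ → A} {g : ℕ → ℕ}

theorem IsBlockMap.blockLen_eq (hg : IsBlockMap y g) {i j : ℕ} (hij : y i = y j) (n : ℕ) :
    blockLen g n i = blockLen g n j := by
  have : ((g^[n] (i + 1) + g^[n] j : ℕ) : ℝ) = (g^[n] (j + 1) + g^[n] i : ℕ) :=
    congrArg _ ((hg.iterate n).length_eq i j hij)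
  push_cast at this
  unfold blockLen
  linarith

theorem IsBlockMap.blockLen_pos (hg : IsBlockMap y g) (n j : ℕ) : 0 < blockLen g n j := by
  unfold blockLen
  have := (hg.iterate n).strictMono (Nat.lt_add_one j)
  rw [sub_pos]
  exact_mod_cast this

theorem sum_Ico_blockLen (g : ℕ → ℕ) (n : ℕ) {i j : ℕ} (hij : i ≤ j) :
    ∑ t ∈ Finset.Ico i j, blockLen g n t = (g^[n] j : ℝ) - g^[n] i :=
  Finset.sum_Ico_sub (fun t => (g^[n] t : ℝ)) hij

theorem IsBlockMap.blockLen_succ (hg : IsBlockMap y g) (n j : ℕ) :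
    blockLen g (n + 1) j = ∑ t ∈ Finset.Ico (g j) (g (j + 1)), blockLen g n t := by
  rw [sum_Ico_blockLen g n (hg.strictMono (Nat.lt_add_one j)).le]
  simp only [blockLen, Function.iterate_succ, Function.comp]

theorem IsIdempotentBlockMap.two_pow_le_blockLen (hg : IsIdempotentBlockMap y g) (n j : ℕ) :
    (2 : ℝ) ^ n ≤ blockLen g n j := by
  induction n generalizing j with
  | zero => simp [blockLen]
  | succ n ih =>
    rw [hg.blockLen_succ]
    have h1 := Finset.sum_le_sum fun t (_ : t ∈ Finset.Ico (g j) (g (j + 1))) => ih t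
    refine le_trans ?_ h1
    rw [Finset.sum_const, Nat.card_Ico, nsmul_eq_mul, pow_succ, mul_comm]
    have h2 := hg.two_le j
    gcongr
    exact_mod_cast (by omega : 2 ≤ g (j + 1) - g j)

/-- Lengths evolve by the incidence matrix `N`, whose support `Occ y g` is transitive by
idempotence; growth at least `2 ^ n` forces `1 < θ`. -/
theorem IsIdempotentBlockMap.exists_blockLen_lim [Finite A] (hg : IsIdempotentBlockMap y g)
    (hy : ∀ a, ∃ n, y n = a) (j : ℕ) :
    ∃ d θ κ, 1 < θ ∧ 0 < κ ∧ ExpPolyLim (fun n => blockLen g n j) d θ κ := by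
  classical
  have := Fintype.ofFinite A
  choose pos hpos using hy
  let N : A → A → ℝ := fun a b =>
    (((Finset.Ico (g (pos a)) (g (pos a + 1))).filter fun t => y t = b).card : ℝ)
  have hNocc : ∀ a b, 0 < N a b ↔ Occ y g a b := fun a b => by
    simp only [N, Nat.cast_pos, Finset.card_pos, Finset.Nonempty, Finset.mem_filter, Finset.mem_Ico]
    constructor
    · rintro ⟨t, ⟨h1, h2⟩, h3⟩
      exact ⟨pos a, t, hpos a, h1, h2, h3⟩
    · intro h
      obtain ⟨t, h1, h2, h3⟩ := hg.exists_occ h (hpos a)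
      exact ⟨t, ⟨h1, h2⟩, h3⟩
  have key := hasExpPolyLim_of_transitive (N := N) (fun a b => Nat.cast_nonneg _)
    (fun a b c hab hbc => (hNocc a c).2 ((hg.occ_iterate 1 a c).1
      ((hg.occ_iterate_add 1 1 a c).2 ⟨b, (hNocc a b).1 hab, (hNocc b c).1 hbc⟩)))
    (f := fun a n => blockLen g n (pos a)) (fun a n => hg.blockLen_pos n _)
    (fun a n => by
      rw [hg.blockLen_succ, ← Finset.sum_fiberwise _ y]
      refine Finset.sum_congr rfl fun b _ => ?_
      rw [Finset.sum_congr rfl fun t ht => hg.blockLen_eq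
        (((Finset.mem_filter.1 ht).2).trans (hpos b).symm) n]
      simp [N]) (y j)
  have heq : (fun n => blockLen g n (pos (y j))) = fun n => blockLen g n j :=
    funext fun n => hg.blockLen_eq (hpos _) n
  simp only [heq] at key
  rcases key with h | ⟨d, θ, κ, hθ, hκ, h⟩
  · exact absurd (congrFun h 0) (hg.blockLen_pos 0 j).ne'
  refine ⟨d, θ, κ, ?_, hκ, h⟩
  by_contra hθ1
  have h0 := h.rescale (d' := 0) hθ (tendsto_scale_div_of_lt (θ' := 2) hθ (by linarith))
  have h1 : (1 : ℝ) ≤ 0 := ge_of_tendsto' h0 fun n => by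
    rw [pow_zero, one_mul, one_le_div (by positivity)]
    exact hg.two_pow_le_blockLen n j
  linarith

theorem IsIdempotentBlockMap.lt_iterate_one (hg : IsIdempotentBlockMap y g) (n : ℕ) :
    n < g^[n] 1 := by
  have h := hg.two_pow_le_blockLen n 0
  have h0 : g^[n] 0 = 0 := (hg.iterate n).map_zero
  rw [blockLen, h0, zero_add, Nat.cast_zero, sub_zero] at h
  exact Nat.lt_two_pow_self.trans_le (by exact_mod_cast h)

/-- Every letter of the sequence occurs in the block of the first one. -/
theorem IsIdempotentBlockMap.occ_zero (hg : IsIdempotentBlockMap y g) (j : ℕ) :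
    Occ y g (y 0) (y j) := by
  refine (hg.occ_iterate j _ _).1 ⟨0, j, rfl, ?_, ?_, rfl⟩
  · rw [(hg.iterate _).map_zero]; exact Nat.zero_le _
  · exact (Nat.lt_succ_self j).trans (hg.lt_iterate_one _)

/-- The letter `y j` occurs in the first block, so a copy of its block of level `n` lies in the
first block of level `n + 1`. Hence no letter outgrows the first. -/
theorem IsIdempotentBlockMap.blockLen_le (hg : IsIdempotentBlockMap y g) (n j : ℕ) :
    blockLen g n j ≤ g^[n + 1] 1 := by
  obtain ⟨t, -, ht, hy⟩ := hg.exists_occ (hg.occ_zero j) rfl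
  rw [← hg.blockLen_eq hy]
  have h1 := (hg.iterate n).strictMono.monotone (show t + 1 ≤ g 1 from ht)
  rw [Function.iterate_succ, Function.comp, blockLen]
  have h2 : ((g^[n] (t + 1) : ℕ) : ℝ) ≤ g^[n] (g 1) := by exact_mod_cast h1
  have h3 : (0 : ℝ) ≤ g^[n] t := Nat.cast_nonneg _
  linarith

/-- `Λ k` measures the first `k` letters: `g^[n] k ~ Λ k * n ^ d * θ ^ n`. -/
structure IsGauge (g : ℕ → ℕ) (d : ℕ) (θ : ℝ) (Λ : ℕ → ℝ) : Prop where
  one_lt : 1 < θ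
  lim : ∀ k, ExpPolyLim (fun n => (g^[n] k : ℝ)) d θ (Λ k)
  mono : Monotone Λ
  zero : Λ 0 = 0
  one_pos : 0 < Λ 1
  step_le : ∃ C, ∀ k, Λ (k + 1) ≤ Λ k + C
  exists_lt_succ : ∀ X, ∃ j, X ≤ Λ j ∧ Λ j < Λ (j + 1)

theorem IsIdempotentBlockMap.exists_gauge [Finite A] (hg : IsIdempotentBlockMap y g)
    (hy : ∀ a, ∃ n, y n = a) : ∃ d θ Λ, IsGauge g d θ Λ := by
  obtain ⟨d, θ, κ, hθ, hκ, hlim⟩ := hg.exists_blockLen_lim hy 0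
  have hθ0 : 0 < θ := zero_lt_one.trans hθ
  have hlim1 : ExpPolyLim (fun n => (g^[n] 1 : ℝ)) d θ κ := by
    refine hlim.congr fun n => ?_
    have h0 : g^[n] 0 = 0 := (hg.iterate n).map_zero
    simp [blockLen, h0]
  have hblock : ∀ j, ∃ l, ExpPolyLim (fun n => blockLen g n j) d θ l := fun j => by
    obtain ⟨d', θ', κ', hθ', hκ', h'⟩ := hg.exists_blockLen_lim hy j
    have hθ'0 : 0 < θ' := zero_lt_one.trans hθ'
    -- A faster `j` is excluded by `blockLen_le`, and a slower one contributes `0`.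
    rcases scale_trichotomy d d' hθ0 hθ'0 with h | ⟨rfl, rfl⟩ | h
    · have h1 := (hlim1.succ hθ0).rescale hθ0 h
      have : κ' ≤ 0 := by
        refine le_of_tendsto_of_tendsto' h' h1 fun n => ?_
        have := hg.blockLen_le n j
        gcongr
      linarith
    · exact ⟨κ', h'⟩
    · exact ⟨0, h'.rescale hθ'0 h⟩
  choose l hl using hblock
  have hall : ∀ k, ∃ L, ExpPolyLim (fun n => (g^[n] k : ℝ)) d θ L := fun k => by
    induction k with
    | zero =>
      refine ⟨0, tendsto_const_nhds.congr fun n => ?_⟩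
      have h0 : g^[n] 0 = 0 := (hg.iterate n).map_zero
      simp [h0]
    | succ k ih =>
      obtain ⟨L, hL⟩ := ih
      refine ⟨L + l k, (hL.add (hl k)).congr fun n => ?_⟩
      simp [blockLen]
  choose Λ hΛ using hall
  have hmono : Monotone Λ := monotone_nat_of_le_succ fun k => by
    refine le_of_tendsto_of_tendsto' (hΛ k) (hΛ (k + 1)) fun n => ?_
    have : (g^[n] k : ℝ) ≤ g^[n] (k + 1) := by
      exact_mod_cast ((hg.iterate n).strictMono (Nat.lt_add_one k)).le
    gcongr
  have hone : Λ 1 = κ := tendsto_nhds_unique (hΛ 1) hlim1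
  -- Applying `g` to `k` amounts to raising the level by one; this self-similarity makes `Λ`
  -- unbounded.
  have hmul : ∀ k, Λ (g k) = Λ k * θ := fun k =>
    tendsto_nhds_unique (hΛ (g k)) ((hΛ k).succ hθ0)
  have hmul' : ∀ n, Λ (g^[n] 1) = κ * θ ^ n := fun n => by
    induction n with
    | zero => simp [hone]
    | succ n ih => rw [Function.iterate_succ_apply', hmul, ih, pow_succ, mul_assoc]
  have hunb : ∀ X, ∃ k, X < Λ k := fun X => by
    have := (tendsto_pow_atTop_atTop_of_one_lt hθ).const_mul_atTop hκ
    obtain ⟨n, hn⟩ := (this.eventually_gt_atTop X).exists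
    exact ⟨g^[n] 1, by rw [hmul']; exact hn⟩
  refine ⟨d, θ, Λ, hθ, hΛ, hmono, ?_, hone ▸ hκ, ?_, fun X => ?_⟩
  · refine tendsto_nhds_unique (hΛ 0) (tendsto_const_nhds.congr fun n => ?_)
    have h0 : g^[n] 0 = 0 := (hg.iterate n).map_zero
    simp [h0]
  · have hstep : ∀ k, Λ (k + 1) = Λ k + l k := fun k => by
      refine tendsto_nhds_unique (hΛ (k + 1)) (((hΛ k).add (hl k)).congr fun n => ?_)
      simp [blockLen]
    choose pos hpos using hy
    obtain ⟨C, hC⟩ := (Set.finite_range fun a => l (pos a)).bddAbove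
    refine ⟨C, fun k => ?_⟩
    rw [hstep]
    have : l k = l (pos (y k)) := by
      refine tendsto_nhds_unique (hl k) ((hl (pos (y k))).congr fun n => ?_)
      simp only [hg.blockLen_eq (hpos (y k))]
    rw [this]
    linarith [hC ⟨y k, rfl⟩]
  · by_contra! hcon
    obtain ⟨k, hk⟩ := hunb X
    have hle : ∀ m, Λ (k + m) ≤ Λ k := fun m => by
      induction m with
      | zero => rfl
      | succ m ih => exact (hcon (k + m) (hk.le.trans (hmono (Nat.le_add_right _ _)))).trans ih
    obtain ⟨k', hk'⟩ := hunb (Λ k)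
    have h1 := hle k'
    have h2 := hmono (Nat.le_add_left k' k)
    linarith

end Subst

/-! ### Free blocks and the lengths of `S`-free intervals. -/

namespace Subst

open Topology

variable {A : Type*} {y : ℕ → A} {g : ℕ → ℕ} {S : Set ℕ}

theorem exists_le_mul_of_tendsto_div {u v : ℕ → ℝ} {L : ℝ} (hv : ∀ n, 0 < v n)
    (h : Tendsto (fun n => u n / v n) atTop (𝓝 L)) : ∃ C, 0 < C ∧ ∀ n, u n ≤ C * v n := by
  obtain ⟨C, hC⟩ := h.bddAbove_range
  refine ⟨max C 1, by positivity, fun n => ?_⟩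
  rw [← div_le_iff₀ (hv n)]
  exact (hC ⟨n, rfl⟩).trans (le_max_left _ _)

theorem ExpPolyLim.tendsto_div {u v : ℕ → ℝ} {d : ℕ} {θ κ κ' : ℝ} (hθ : 0 < θ) (hκ' : κ' ≠ 0)
    (hu : ExpPolyLim u d θ κ) (hv : ExpPolyLim v d θ κ') :
    Tendsto (fun n => u n / v n) atTop (𝓝 (κ / κ')) := by
  refine (Tendsto.div hu hv hκ').congr' ?_
  filter_upwards [eventually_ge_atTop 1] with n hn
  exact div_div_div_cancel_right₀ (scale_pos hθ hn).ne' _ _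

/-- The sums of an exponentially growing sequence are of the order of its last term. -/
theorem ExpPolyLim.sum_range {u : ℕ → ℝ} {d : ℕ} {θ κ : ℝ} (hθ : 1 < θ)
    (hu : ExpPolyLim u d θ κ) : ∃ κ', ExpPolyLim (fun n => ∑ i ∈ Finset.range n, u i) d θ κ' := by
  have h1 : ExpPolyLim (fun _ => 1) 0 1 1 := by simp [ExpPolyLim]
  refine ⟨_, (h1.conv_of_lt one_pos hθ hu).congr fun n => ?_⟩
  simp only [one_mul]

/-- The block of `j` does not meet `S`. -/
def FreeBlock (g : ℕ → ℕ) (S : Set ℕ) (j : ℕ) : Prop := ∀ t, g j ≤ t → t < g (j + 1) → t ∉ S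

/-- By idempotence, the blocks of `j` at all levels from 1 on contain the same letters. Level 0,
where a block is one position, is excluded. -/
theorem IsIdempotentBlockMap.freeBlock_iterate_iff (hg : IsIdempotentBlockMap y g)
    (hS : ∀ i j, y i = y j → (i ∈ S ↔ j ∈ S)) (n j : ℕ) :
    FreeBlock g^[n + 1] S j ↔ FreeBlock g S j := by
  constructor
  · intro h t h1 h2 ht
    obtain ⟨t', h1', h2', hy⟩ := (hg.iterate (n + 1)).exists_occ
      ((hg.occ_iterate n _ _).2 ⟨j, t, rfl, h1, h2, rfl⟩) rfl
    exact h t' h1' h2' ((hS _ _ hy).2 ht)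
  · intro h t h1 h2 ht
    obtain ⟨t', h1', h2', hy⟩ := hg.exists_occ
      ((hg.occ_iterate n _ _).1 ⟨j, t, rfl, h1, h2, rfl⟩) rfl
    exact h t' h1' h2' ((hS _ _ hy).2 ht)

theorem IsBlockMap.freeBlock_congr (hg : IsBlockMap y g)
    (hS : ∀ i j, y i = y j → (i ∈ S ↔ j ∈ S)) {i j : ℕ} (hij : y i = y j)
    (h : FreeBlock g S i) : FreeBlock g S j := by
  intro t h1 h2 ht
  obtain ⟨t', h1', h2', hy⟩ := hg.exists_occ ⟨j, t, rfl, h1, h2, rfl⟩ hij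
  exact h t' h1' h2' ((hS _ _ hy).2 ht)

theorem IsBlockMap.exists_length_le [Finite A] (hg : IsBlockMap y g)
    (hy : ∀ a, ∃ n, y n = a) : ∃ W : ℕ, ∀ j, g (j + 1) ≤ g j + W := by
  choose pos hpos using hy
  obtain ⟨W, hW⟩ := (Set.finite_range fun a => g (pos a + 1) - g (pos a)).bddAbove
  refine ⟨W, fun j => ?_⟩
  have h1 := hg.length_eq _ _ (hpos (y j))
  have h2 : g (pos (y j) + 1) - g (pos (y j)) ≤ W := hW ⟨y j, rfl⟩
  have h3 := hg.strictMono (Nat.lt_add_one (pos (y j)))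
  omega

/-- If block lengths are at most `W`, a gap of `2 * W + 1` positions contains the whole block
following the one where it starts. -/
theorem IsBlockMap.exists_freeBlock [Finite A] (hg : IsBlockMap y g)
    (hy : ∀ a, ∃ n, y n = a) (hgap : ∀ K, ∃ n, ∀ m, n ≤ m → m ≤ n + K → m ∉ S) :
    ∃ j, FreeBlock g S j := by
  obtain ⟨W, hW⟩ := hg.exists_length_le hy
  obtain ⟨n, hn⟩ := hgap (2 * W)
  obtain ⟨j, h1, h2⟩ := hg.exists_block n
  have h3 := hW j
  have h4 := hW (j + 1)
  exact ⟨j + 1, fun t ht1 ht2 => hn t (by omega) (by omega)⟩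

section Gap

variable {C₁ : ℝ} {W : ℕ} {φ : ℕ → ℝ}

theorem IsBlockMap.sub_le_of_free (hg : IsBlockMap y g) (hC₁ : 0 ≤ C₁) (hφ : ∀ n, 0 ≤ φ n)
    (hfree : ∀ n j, FreeBlock g^[n] S j → blockLen g n j ≤ C₁ * φ n) {n i k : ℕ} (hik : i ≤ k)
    (hkW : k ≤ i + W) (h : ∀ t, g^[n] i ≤ t → t < g^[n] k → t ∉ S) :
    (g^[n] k : ℝ) - g^[n] i ≤ W * (C₁ * φ n) := by
  have hmono := (hg.iterate n).strictMono.monotone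
  rw [← sum_Ico_blockLen g n hik]
  calc ∑ t ∈ Finset.Ico i k, blockLen g n t ≤ ∑ t ∈ Finset.Ico i k, C₁ * φ n := by
        refine Finset.sum_le_sum fun t ht => hfree n t fun s hs1 hs2 => ?_
        rw [Finset.mem_Ico] at ht
        exact h s ((hmono ht.1).trans hs1) (hs2.trans_le (hmono (show t + 1 ≤ k from ht.2)))
    _ = ((k - i : ℕ) : ℝ) * (C₁ * φ n) := by simp
    _ ≤ _ := by
        have := mul_nonneg hC₁ (hφ n)
        gcongr
        omega

/-- A free run from the left end of a block consists of at most `W` free blocks one level down, then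
a run from the left end of another block. Each level thus adds at most `W * C₁ * φ i`. -/
theorem IsBlockMap.initial_gap_le (hg : IsBlockMap y g) (hC₁ : 0 ≤ C₁) (hφ : ∀ n, 0 ≤ φ n)
    (hφ0 : 1 ≤ C₁ * φ 0) (hW : ∀ j, g (j + 1) ≤ g j + W)
    (hfree : ∀ n j, FreeBlock g^[n] S j → blockLen g n j ≤ C₁ * φ n) (n : ℕ) {j e : ℕ}
    (h1 : g^[n] j ≤ e) (h2 : e ≤ g^[n] (j + 1)) (h : ∀ t, g^[n] j ≤ t → t < e → t ∉ S) :
    (e : ℝ) - g^[n] j ≤ C₁ * φ 0 + W * C₁ * ∑ i ∈ Finset.range n, φ i := by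
  induction n generalizing j e with
  | zero =>
    have : (e : ℝ) ≤ j + 1 := by exact_mod_cast h2
    simp
    linarith
  | succ n ih =>
    obtain ⟨k, hk1, hk2⟩ := (hg.iterate n).exists_block e
    have hmono := (hg.iterate n).strictMono
    rw [Function.iterate_succ, Function.comp] at h1 h2
    simp only [Function.iterate_succ, Function.comp] at h ⊢
    have hjk : g j ≤ k := by
      have := hmono.lt_iff_lt.1 (h1.trans_lt hk2)
      omega
    have hkj : k ≤ g (j + 1) := hmono.le_iff_le.1 (hk1.trans h2)
    have e1 := hg.sub_le_of_free hC₁ hφ hfree (n := n) hjk (hkj.trans (hW j))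
      fun t ht1 ht2 => h t ht1 (ht2.trans_le hk1)
    have e2 := ih hk1 hk2.le fun t ht1 ht2 => h t ((hmono.monotone hjk).trans ht1) ht2
    rw [Finset.sum_range_succ]
    linarith

theorem IsBlockMap.final_gap_le (hg : IsBlockMap y g) (hC₁ : 0 ≤ C₁) (hφ : ∀ n, 0 ≤ φ n)
    (hφ0 : 1 ≤ C₁ * φ 0) (hW : ∀ j, g (j + 1) ≤ g j + W)
    (hfree : ∀ n j, FreeBlock g^[n] S j → blockLen g n j ≤ C₁ * φ n) (n : ℕ) {j s : ℕ}
    (h1 : g^[n] j ≤ s) (h2 : s < g^[n] (j + 1)) (h : ∀ t, s ≤ t → t < g^[n] (j + 1) → t ∉ S) :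
    (g^[n] (j + 1) : ℝ) - s ≤ C₁ * φ 0 + W * C₁ * ∑ i ∈ Finset.range n, φ i := by
  induction n generalizing j s with
  | zero =>
    have : (j : ℝ) ≤ s := by exact_mod_cast h1
    simp
    linarith
  | succ n ih =>
    obtain ⟨k, hk1, hk2⟩ := (hg.iterate n).exists_block s
    have hmono := (hg.iterate n).strictMono
    rw [Function.iterate_succ, Function.comp] at h1 h2
    simp only [Function.iterate_succ, Function.comp] at h ⊢
    have hjk : g j ≤ k := by
      have := hmono.lt_iff_lt.1 (h1.trans_lt hk2)
      omega
    have hkj : k + 1 ≤ g (j + 1) := hmono.lt_iff_lt.1 (hk1.trans_lt h2)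
    have hWj := hW j
    have e1 := hg.sub_le_of_free (W := W) hC₁ hφ hfree (n := n) hkj (by omega)
      fun t ht1 ht2 => h t (hk2.le.trans ht1) ht2
    have e2 := ih hk1 hk2 fun t ht1 ht2 => h t ht1 (ht2.trans_le (hmono.monotone hkj))
    rw [Finset.sum_range_succ]
    linarith

/-- An `S`-free interval in a block of level `n` is not much longer than the free blocks of levels
at most `n`. -/
theorem IsBlockMap.gap_le (hg : IsBlockMap y g) (hC₁ : 0 ≤ C₁) (hφ : ∀ n, 0 ≤ φ n)
    (hφ0 : 1 ≤ C₁ * φ 0) (hW : ∀ j, g (j + 1) ≤ g j + W)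
    (hfree : ∀ n j, FreeBlock g^[n] S j → blockLen g n j ≤ C₁ * φ n) (n : ℕ) {j s e : ℕ}
    (h1 : g^[n] j ≤ s) (hse : s < e) (h2 : e ≤ g^[n] (j + 1)) (h : ∀ t, s ≤ t → t < e → t ∉ S) :
    (e : ℝ) - s ≤ 2 * (C₁ * φ 0 + W * C₁ * ∑ i ∈ Finset.range n, φ i) := by
  induction n generalizing j s e with
  | zero =>
    have : (j : ℝ) ≤ s := by exact_mod_cast h1
    have : (e : ℝ) ≤ j + 1 := by exact_mod_cast h2
    simp
    linarith
  | succ n ih =>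
    obtain ⟨k, hk1, hk2⟩ := (hg.iterate n).exists_block s
    obtain ⟨l, hl1, hl2⟩ := (hg.iterate n).exists_block e
    have hmono := (hg.iterate n).strictMono
    rw [Function.iterate_succ, Function.comp] at h1 h2
    have hjk : g j ≤ k := by
      have := hmono.lt_iff_lt.1 (h1.trans_lt hk2)
      omega
    have hlj : l ≤ g (j + 1) := hmono.le_iff_le.1 (hl1.trans h2)
    have hkl : k ≤ l := by
      have := hmono.lt_iff_lt.1 ((hk1.trans hse.le).trans_lt hl2)
      omega
    have hWj := hW j
    have hWC : 0 ≤ W * C₁ * φ n := mul_nonneg (mul_nonneg (Nat.cast_nonneg _) hC₁) (hφ n)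
    rw [Finset.sum_range_succ]
    -- Once the interval leaves a single lower block, it splits into the free end of one block, at
    -- most `W` free blocks, and the free start of another. This happens only once, whence the
    -- factor 2.
    rcases hkl.eq_or_lt with rfl | hkl
    · have := ih hk1 hse hl2.le h
      linarith
    · have hlk : g^[n] (k + 1) ≤ g^[n] l := hmono.monotone hkl
      have e1 := hg.final_gap_le hC₁ hφ hφ0 hW hfree n hk1 hk2
        fun t ht1 ht2 => h t ht1 (by omega)
      have e2 := hg.sub_le_of_free (W := W) hC₁ hφ hfree (n := n) (i := k + 1) hkl (by omega)
        fun t ht1 ht2 => h t (by omega) (by omega)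
      have e3 := hg.initial_gap_le hC₁ hφ hφ0 hW hfree n hl1 hl2.le
        fun t ht1 ht2 => h t (by omega) ht2
      linarith

end Gap

theorem IsIdempotentBlockMap.exists_dominant_freeBlock [Finite A] (hg : IsIdempotentBlockMap y g)
    (hy : ∀ a, ∃ n, y n = a) (hS : ∀ i j, y i = y j → (i ∈ S ↔ j ∈ S))
    (hex : ∃ j, FreeBlock g S j) :
    ∃ j₀, FreeBlock g S j₀ ∧ ∃ C, 0 < C ∧ ∀ j, FreeBlock g S j →
      ∀ n, blockLen g n j ≤ C * blockLen g n j₀ := by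
  have hy' := hy
  choose pos hpos using hy'
  choose d θ κ hθ hκ hlim using fun j => hg.exists_blockLen_lim hy j
  obtain ⟨a₀, ha₀, hmax⟩ := Set.exists_max_image {a | FreeBlock g S (pos a)}
    (fun a => toLex (θ (pos a), d (pos a))) (Set.toFinite _) (by
      obtain ⟨j, hj⟩ := hex
      exact ⟨y j, hg.freeBlock_congr hS (hpos (y j)).symm hj⟩)
  set j₀ := pos a₀
  have hpair : ∀ a, FreeBlock g S (pos a) → ∃ C, 0 < C ∧
      ∀ n, blockLen g n (pos a) ≤ C * blockLen g n j₀ := fun a ha => by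
    have hθ0 : 0 < θ (pos a) := zero_lt_one.trans (hθ _)
    have : ∃ L, ExpPolyLim (fun n => blockLen g n (pos a)) (d j₀) (θ j₀) L := by
      rcases Prod.Lex.toLex_le_toLex.1 (hmax a ha) with h | ⟨h, h'⟩
      · exact ⟨0, (hlim (pos a)).rescale hθ0 (tendsto_scale_div_of_lt hθ0 h)⟩
      · simp only at h h'
        rcases h'.eq_or_lt with h' | h'
        · exact ⟨κ (pos a), h ▸ h' ▸ hlim (pos a)⟩
        · exact ⟨0, (hlim (pos a)).rescale hθ0 (h ▸ tendsto_scale_div_of_degree_lt hθ0 h')⟩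
    obtain ⟨L, hL⟩ := this
    exact exists_le_mul_of_tendsto_div (fun n => hg.blockLen_pos n _)
      (hL.tendsto_div (zero_lt_one.trans (hθ _)) (hκ _).ne' (hlim j₀))
  have hall : ∀ a, ∃ C, 0 < C ∧ (FreeBlock g S (pos a) →
      ∀ n, blockLen g n (pos a) ≤ C * blockLen g n j₀) := fun a => by
    by_cases ha : FreeBlock g S (pos a)
    · obtain ⟨C, hC, h⟩ := hpair a ha
      exact ⟨C, hC, fun _ => h⟩
    · exact ⟨1, one_pos, fun h => absurd h ha⟩
  choose C hC hCle using hall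
  obtain ⟨K, hK⟩ := (Set.finite_range C).bddAbove
  refine ⟨j₀, ha₀, max K 1, by positivity, fun j hj n => ?_⟩
  rw [← hg.blockLen_eq (hpos (y j))]
  refine (hCle (y j) (hg.freeBlock_congr hS (hpos (y j)).symm hj) n).trans ?_
  exact mul_le_mul_of_nonneg_right ((hK ⟨y j, rfl⟩).trans (le_max_left _ _))
    (hg.blockLen_pos _ _).le

/-- Some free block dominates every `S`-free interval contained in a block of the same level. -/
theorem IsIdempotentBlockMap.exists_gap_bound [Finite A] (hg : IsIdempotentBlockMap y g)
    (hy : ∀ a, ∃ n, y n = a) (hS : ∀ i j, y i = y j → (i ∈ S ↔ j ∈ S))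
    (hex : ∃ j, FreeBlock g S j) :
    ∃ j₀, FreeBlock g S j₀ ∧ ∃ C, 0 < C ∧ ∀ n j s e, g^[n] j ≤ s → s < e → e ≤ g^[n] (j + 1) →
      (∀ t, s ≤ t → t < e → t ∉ S) → (e : ℝ) - s ≤ C * blockLen g n j₀ := by
  obtain ⟨j₀, hj₀, C, hC, hle⟩ := hg.exists_dominant_freeBlock hy hS hex
  obtain ⟨W, hW⟩ := hg.exists_length_le hy
  obtain ⟨d, θ, κ, hθ, hκ, hlim⟩ := hg.exists_blockLen_lim hy j₀
  have hθ0 : 0 < θ := zero_lt_one.trans hθ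
  set φ : ℕ → ℝ := fun n => blockLen g n j₀ with hφ
  have hφpos : ∀ n, 0 < φ n := fun n => hg.blockLen_pos n j₀
  have hφ0 : φ 0 = 1 := by simp [hφ, blockLen]
  set C₁ := max C 1
  have hC₁ : 0 < C₁ := by positivity
  have hfree : ∀ n j, FreeBlock g^[n] S j → blockLen g n j ≤ C₁ * φ n := fun n j hj => by
    cases n with
    | zero =>
      rw [hφ0, mul_one]
      simp [blockLen, C₁]
    | succ n =>
      refine (hle j ((hg.freeBlock_iterate_iff hS n j).1 hj) (n + 1)).trans ?_
      exact mul_le_mul_of_nonneg_right (le_max_left _ _) (hφpos _).le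
  -- As `1 < θ`, the sum over the levels below `n` is at most a constant times `φ n`.
  obtain ⟨κ', hκ'⟩ := hlim.sum_range hθ
  obtain ⟨C₂, hC₂, hsum⟩ := exists_le_mul_of_tendsto_div hφpos (hκ'.tendsto_div hθ0 hκ.ne' hlim)
  refine ⟨j₀, hj₀, 2 * (C₁ + W * C₁ * C₂), by positivity, fun n j s e h1 hse h2 h => ?_⟩
  refine (hg.gap_le hC₁.le (fun n => (hφpos n).le)
    (by rw [hφ0, mul_one]; exact le_max_right _ _) hW hfree n h1 hse h2 h).trans ?_
  have h3 : 1 ≤ φ n := (one_le_pow₀ one_le_two).trans (hg.two_pow_le_blockLen n j₀)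
  have h4 : W * C₁ * ∑ i ∈ Finset.range n, φ i ≤ W * C₁ * (C₂ * φ n) :=
    mul_le_mul_of_nonneg_left (hsum n) (by positivity)
  have h5 : C₁ * 1 ≤ C₁ * φ n := mul_le_mul_of_nonneg_left h3 hC₁.le
  rw [hφ0]
  linarith

theorem IsIdempotentBlockMap.exists_mul_blockLen_lt [Finite A] (hg : IsIdempotentBlockMap y g)
    (hy : ∀ a, ∃ n, y n = a) (j : ℕ) (K : ℝ) :
    ∃ k, ∀ᶠ n in atTop, K * blockLen g n j < blockLen g (n + k) j := by
  obtain ⟨d, θ, κ, hθ, hκ, hlim⟩ := hg.exists_blockLen_lim hy j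
  have hθ0 : 0 < θ := zero_lt_one.trans hθ
  obtain ⟨k, hk⟩ := pow_unbounded_of_one_lt K hθ
  refine ⟨k, ?_⟩
  have h := (hlim.shift hθ0 k).tendsto_div hθ0 hκ.ne' hlim
  rw [mul_div_cancel_left₀ _ hκ.ne'] at h
  filter_upwards [h.eventually (lt_mem_nhds hk)] with n hn
  rwa [lt_div_iff₀ (hg.blockLen_pos n j)] at hn

end Subst

/-! ### Comparison of two block structures on the same set. -/

namespace Subst

open Topology

theorem IsGauge.nonneg {g : ℕ → ℕ} {d : ℕ} {θ : ℝ} {Λ : ℕ → ℝ} (h : IsGauge g d θ Λ) (k : ℕ) :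
    0 ≤ Λ k := h.zero ▸ h.mono (Nat.zero_le k)

theorem IsGauge.succ_pos {g : ℕ → ℕ} {d : ℕ} {θ : ℝ} {Λ : ℕ → ℝ} (h : IsGauge g d θ Λ) (k : ℕ) :
    0 < Λ (k + 1) := h.one_pos.trans_le (h.mono (by omega))

/-- A strict inequality between limiting constants survives at large levels. No relation between `n`
and `m` is imposed beyond that of the scales, so `exists_scale_between` can choose both. -/
theorem IsGauge.eventually_le {g h : ℕ → ℕ} {d e : ℕ} {α β : ℝ} {Λ M : ℕ → ℝ}
    (hΛ : IsGauge g d α Λ) (hM : IsGauge h e β M) {r : ℝ} (hr : 0 < r) {k k' : ℕ}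
    (hk : Λ k < r * M k') :
    ∃ N : ℕ, ∀ n m : ℕ, N ≤ n → N ≤ m → r * ((n : ℝ) ^ d * α ^ n) < (m : ℝ) ^ e * β ^ m →
      g^[n] k ≤ h^[m] k' := by
  obtain ⟨u, hu1, hu2⟩ := exists_between hk
  have hu0 : 0 < u := (hΛ.nonneg k).trans_lt hu1
  have hu2' : u / r < M k' := by rw [div_lt_iff₀ hr]; linarith
  obtain ⟨N₁, hN₁⟩ := eventually_atTop.1 ((hΛ.lim k).eventually (gt_mem_nhds hu1))
  obtain ⟨N₂, hN₂⟩ := eventually_atTop.1 ((hM.lim k').eventually (lt_mem_nhds hu2'))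
  refine ⟨max 1 (max N₁ N₂), fun n m hn hm hnm => ?_⟩
  have hn1 := scale_pos (d := d) (zero_lt_one.trans hΛ.one_lt) (show 1 ≤ n by omega)
  have hm1 := scale_pos (d := e) (zero_lt_one.trans hM.one_lt) (show 1 ≤ m by omega)
  have h1 := hN₁ n (by omega)
  have h2 := hN₂ m (by omega)
  rw [div_lt_iff₀ hn1] at h1
  rw [lt_div_iff₀ hm1] at h2
  have h3 := mul_lt_mul_of_pos_left hnm (div_pos hu0 hr)
  rw [← mul_assoc, div_mul_cancel₀ _ hr.ne'] at h3
  have : (g^[n] k : ℝ) < h^[m] k' := h1.trans (h3.trans h2)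
  exact (by exact_mod_cast this : g^[n] k < h^[m] k').le

theorem IsGauge.eventually_ge {g h : ℕ → ℕ} {d e : ℕ} {α β : ℝ} {Λ M : ℕ → ℝ}
    (hΛ : IsGauge g d α Λ) (hM : IsGauge h e β M) {r : ℝ} (hr : 0 < r) {k k' : ℕ}
    (hk : r * M k' < Λ k) :
    ∃ N : ℕ, ∀ n m : ℕ, N ≤ n → N ≤ m → (m : ℝ) ^ e * β ^ m < r * ((n : ℝ) ^ d * α ^ n) →
      h^[m] k' ≤ g^[n] k := by
  obtain ⟨N, hN⟩ := hM.eventually_le hΛ (inv_pos.2 hr) (k := k') (k' := k)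
    (by rwa [lt_inv_mul_iff₀ hr])
  exact ⟨N, fun n m hn hm hnm => hN m n hm hn (by rwa [inv_mul_lt_iff₀ hr])⟩

/-- Phrased with products because `m` will be `M j'`, which vanishes at `j' = 0`. -/
theorem exists_lt_of_mul_lt {ρ m l : ℝ} (hm : 0 ≤ m) (h : ρ * m < l) : ∃ r, ρ < r ∧ r * m < l := by
  rcases hm.eq_or_lt with rfl | hm
  · exact ⟨ρ + 1, by linarith, by simpa using h⟩
  · obtain ⟨r, h1, h2⟩ := exists_between ((lt_div_iff₀ hm).2 h)
    exact ⟨r, h1, (lt_div_iff₀ hm).1 h2⟩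

section Core

variable {A B : Type*} {y : ℕ → A} {z : ℕ → B} {g h : ℕ → ℕ} {S : Set ℕ} {d e : ℕ} {α β : ℝ}
  {Λ M : ℕ → ℝ}

theorem exists_not_freeBlock (hg : IsBlockMap y g) (hΛ : IsGauge g d α Λ) (hS : S.Infinite)
    (X : ℝ) : ∃ j, X ≤ Λ j ∧ ¬FreeBlock g S j := by
  obtain ⟨j₀, hj₀, -⟩ := hΛ.exists_lt_succ X
  obtain ⟨s, hs, hsj⟩ := hS.exists_gt (g j₀)
  obtain ⟨j, h1, h2⟩ := hg.exists_block s
  have hjj : j₀ ≤ j := by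
    have := hg.strictMono.lt_iff_lt.1 (hsj.trans h2)
    omega
  exact ⟨j, hj₀.trans (hΛ.mono hjj), fun hf => hf s h1 h2 hs⟩

/-- A free block cannot occupy a positive proportion of the positions. -/
theorem not_freeBlock_of_lt_succ (hg : IsIdempotentBlockMap y g) (hh : IsIdempotentBlockMap z h)
    (hSy : ∀ i j, y i = y j → (i ∈ S ↔ j ∈ S)) (hSz : ∀ i j, z i = z j → (i ∈ S ↔ j ∈ S))
    (hΛ : IsGauge g d α Λ) (hM : IsGauge h e β M) (hαβ : MulIndep α β) (hS : S.Infinite)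
    {j' : ℕ} (hj' : M j' < M (j' + 1)) : ¬FreeBlock h S j' := by
  intro hfree
  obtain ⟨C, hC⟩ := hΛ.step_le
  -- This size of `Λ j` ensures `Λ (j + 1) * M j' < Λ j * M (j' + 1)`, the steps of `Λ` being at
  -- most `C`. Scale ratios then exist that put the block of `j`, which meets `S`, inside the free
  -- block of `j'`.
  obtain ⟨j, hj, hlive⟩ := exists_not_freeBlock hg.toIsBlockMap hΛ hS
    ((C * M j' + 1) / (M (j' + 1) - M j'))
  rw [div_le_iff₀ (by linarith)] at hj
  set ρ := Λ (j + 1) / M (j' + 1) with hρ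
  have hρ0 : 0 < ρ := div_pos (hΛ.succ_pos j) (hM.succ_pos j')
  have hρ1 : ρ * M j' < Λ j := by
    rw [hρ, div_mul_eq_mul_div, div_lt_iff₀ (hM.succ_pos j')]
    have := mul_le_mul_of_nonneg_right (hC j) (hM.nonneg j')
    nlinarith
  obtain ⟨r', hr1, hr2⟩ := exists_lt_of_mul_lt (hM.nonneg j') hρ1
  obtain ⟨r, hρr, hrr'⟩ := exists_between hr1
  have hr0 : 0 < r := hρ0.trans hρr
  obtain ⟨N₁, hN₁⟩ := hΛ.eventually_le hM hr0 (k := j + 1) (k' := j' + 1)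
    (by rwa [hρ, div_lt_iff₀ (hM.succ_pos j')] at hρr)
  obtain ⟨N₂, hN₂⟩ := hΛ.eventually_ge hM (hr0.trans hrr') hr2
  obtain ⟨n, m, hn, hm, h1, h2⟩ := exists_scale_between hΛ.one_lt hM.one_lt hαβ d e hr0 hrr'
    (max 1 (max N₁ N₂))
  have e1 := hN₁ n m (by omega) (by omega) h1
  have e2 := hN₂ n m (by omega) (by omega) h2
  obtain ⟨n, rfl⟩ := Nat.exists_eq_add_of_le' (show 1 ≤ n by omega)
  obtain ⟨m, rfl⟩ := Nat.exists_eq_add_of_le' (show 1 ≤ m by omega)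
  rw [← hg.freeBlock_iterate_iff hSy n] at hlive
  rw [← hh.freeBlock_iterate_iff hSz m] at hfree
  exact hlive fun t ht1 ht2 => hfree t (e2.trans ht1) (ht2.trans_le e1)

/-- A set that is saturated for two self-similar sequences with multiplicatively independent
growth rates has bounded gaps. -/
theorem bounded_gaps_of_mulIndep [Finite A] [Finite B]
    (hg : IsIdempotentBlockMap y g) (hh : IsIdempotentBlockMap z h)
    (hy : ∀ a, ∃ n, y n = a) (hz : ∀ b, ∃ n, z n = b)
    (hSy : ∀ i j, y i = y j → (i ∈ S ↔ j ∈ S)) (hSz : ∀ i j, z i = z j → (i ∈ S ↔ j ∈ S))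
    (hΛ : IsGauge g d α Λ) (hM : IsGauge h e β M) (hαβ : MulIndep α β) (hS : S.Infinite) :
    ∃ K, ∀ n, ∃ m, n ≤ m ∧ m ≤ n + K ∧ m ∈ S := by
  by_contra! hgap
  obtain ⟨ja, hja, CA, hCA, hA⟩ := hg.exists_gap_bound hy hSy
    (hg.exists_freeBlock hy hgap)
  obtain ⟨j', hj', CB, hCB, hB⟩ := hh.exists_gap_bound hz hSz
    (hh.exists_freeBlock hz hgap)
  have hMj : M (j' + 1) = M j' := by
    refine le_antisymm (not_lt.1 fun hlt => ?_) (hM.mono (Nat.le_succ j'))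
    exact not_freeBlock_of_lt_succ hg hh hSy hSz hΛ hM hαβ hS hlt hj'
  have hMpos : 0 < M j' := hMj ▸ hM.succ_pos j'
  -- The shift `k` depends only on `ja` and the two gap constants, and is fixed before `j` and the
  -- levels.
  obtain ⟨k, hk⟩ := hg.exists_mul_blockLen_lt hy ja (CB * CA)
  obtain ⟨N₀, hN₀⟩ := eventually_atTop.1 hk
  -- The strict step leaves room for a scale ratio between `Λ j / M j'` and `Λ (j + 1) / M j'`,
  -- which puts the block of `j'` inside that of `j`. The lower bound on `Λ j` makes the block of
  -- `ja`, `k` levels up, end before the first block of `z` does.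
  obtain ⟨j, hj, hjlt⟩ := hΛ.exists_lt_succ (Λ (g^[k] (ja + 1)) / M 1 * M j')
  rw [← le_div_iff₀ hMpos, div_le_iff₀ hM.one_pos] at hj
  obtain ⟨r', hr1, hr2⟩ := exists_between (div_lt_div_of_pos_right hjlt hMpos)
  obtain ⟨r, hρr, hrr'⟩ := exists_between hr1
  have hr0 : 0 < r := (div_nonneg (hΛ.nonneg j) hMpos.le).trans_lt hρr
  obtain ⟨N₁, hN₁⟩ := hΛ.eventually_le hM hr0 ((div_lt_iff₀ hMpos).1 hρr)
  obtain ⟨N₂, hN₂⟩ := hΛ.eventually_ge hM (hr0.trans hrr') (k := j + 1) (k' := j' + 1)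
    (by rw [hMj]; exact (lt_div_iff₀ hMpos).1 hr2)
  obtain ⟨N₃, hN₃⟩ := hΛ.eventually_le hM hr0 (k := g^[k] (ja + 1)) (k' := 1)
    (hj.trans_lt (mul_lt_mul_of_pos_right hρr hM.one_pos))
  obtain ⟨n, m, hn, hm, h1, h2⟩ := exists_scale_between hΛ.one_lt hM.one_lt hαβ d e hr0 hrr'
    (max (max 1 N₀) (max N₁ (max N₂ N₃)))
  have e1 := hN₁ n m (by omega) (by omega) h1
  have e2 := hN₂ n m (by omega) (by omega) h2
  have e3 := hN₃ n m (by omega) (by omega) h1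
  have e4 := hN₀ n (by omega)
  rw [← Function.iterate_add_apply] at e3
  obtain ⟨n, rfl⟩ := Nat.exists_eq_add_of_le' (show 1 ≤ n by omega)
  obtain ⟨m, rfl⟩ := Nat.exists_eq_add_of_le' (show 1 ≤ m by omega)
  have hB' := (hh.freeBlock_iterate_iff hSz m j').2 hj'
  have hA' := (hg.freeBlock_iterate_iff hSy (n + k) ja).2 hja
  rw [show n + k + 1 = n + 1 + k by omega] at hA'
  have f1 : blockLen h (m + 1) j' ≤ CA * blockLen g (n + 1) ja :=
    hA (n + 1) j _ _ e1 ((hh.iterate _).strictMono (Nat.lt_add_one j')) e2 hB'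
  have f2 : blockLen g (n + 1 + k) ja ≤ CB * blockLen h (m + 1) j' :=
    hB (m + 1) 0 _ _ (by rw [(hh.iterate _).map_zero]; exact Nat.zero_le _)
      ((hg.iterate _).strictMono (Nat.lt_add_one ja)) e3 hA'
  have f3 := mul_le_mul_of_nonneg_left f1 hCB.le
  linarith

end Core

end Subst

/-! ### From substitutions to block maps. -/

namespace Subst

open Topology

variable {A : Type*} {σ : A → List A} {y : ℕ → A}

/-- The length of the image of the prefix of length `k`. -/
def imageLen {A : Type*} (σ : A → List A) (y : ℕ → A) (k : ℕ) : ℕ :=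
  (onWord σ (pre y k)).length

theorem onWord_append (σ : A → List A) (v w : List A) :
    onWord σ (v ++ w) = onWord σ v ++ onWord σ w := List.flatMap_append

theorem onWord_iterate_append (σ : A → List A) (n : ℕ) (v w : List A) :
    (onWord σ)^[n] (v ++ w) = (onWord σ)^[n] v ++ (onWord σ)^[n] w := by
  induction n generalizing v w with
  | zero => rfl
  | succ n ih => simp only [Function.iterate_succ, Function.comp, onWord_append, ih]

theorem pre_succ (y : ℕ → A) (k : ℕ) : pre y (k + 1) = pre y k ++ [y k] := by
  simp [pre, List.range_succ]

theorem onWord_iterate_nil (σ : A → List A) (n : ℕ) : (onWord σ)^[n] [] = [] := by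
  induction n with
  | zero => rfl
  | succ n ih => rw [Function.iterate_succ_apply]; exact ih

theorem IsSubstitution.length_pos (hσ : IsSubstitution σ) (a : A) : 0 < (σ a).length := by
  rw [List.length_pos_iff]
  intro h
  have h1 : ∀ n, (iter σ (n + 1) a).length = 0 := fun n => by
    have : onWord σ [a] = [] := by simp [onWord, h]
    rw [iter, Function.iterate_succ_apply, this, onWord_iterate_nil]
    rfl
  obtain ⟨n, hn, hn1⟩ := (((hσ a).eventually_gt_atTop 0).and (eventually_ge_atTop 1)).exists
  obtain ⟨n, rfl⟩ := Nat.exists_eq_add_of_le' hn1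
  exact hn.ne' (h1 n)

theorem imageLen_succ (σ : A → List A) (y : ℕ → A) (k : ℕ) :
    imageLen σ y (k + 1) = imageLen σ y k + (σ (y k)).length := by
  rw [imageLen, pre_succ, onWord_append, List.length_append, imageLen]
  simp [onWord]

theorem MapsSeq.getElem?_eq (h : MapsSeq σ y y) (i t : ℕ) (ht : t < (σ (y i)).length) :
    (σ (y i))[t]? = some (y (imageLen σ y i + t)) := by
  have h1 := h (i + 1)
  have h2 : onWord σ (pre y (i + 1)) = onWord σ (pre y i) ++ σ (y i) := by
    rw [pre_succ, onWord_append]; simp [onWord]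
  have h3 : (onWord σ (pre y (i + 1)))[imageLen σ y i + t]? =
      (pre y (imageLen σ y (i + 1)))[imageLen σ y i + t]? :=
    congrArg (fun w => w[imageLen σ y i + t]?) h1
  have h4 : (onWord σ (pre y i) ++ σ (y i))[imageLen σ y i + t]? =
      (σ (y i))[imageLen σ y i + t - imageLen σ y i]? :=
    List.getElem?_append_right (Nat.le_add_right _ _)
  rw [h2, h4, Nat.add_sub_cancel_left] at h3
  rw [h3, pre, List.getElem?_map, List.getElem?_range]
  · rfl
  · rw [imageLen_succ]
    omega

theorem isBlockMap_imageLen (hσ : IsSubstitution σ) (h : MapsSeq σ y y) :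
    IsBlockMap y (imageLen σ y) where
  map_zero := rfl
  strictMono := strictMono_nat_of_lt_succ fun k => by
    rw [imageLen_succ]
    exact Nat.lt_add_of_pos_right (hσ.length_pos _)
  length_eq i j hij := by
    rw [imageLen_succ, imageLen_succ, hij]
    omega
  apply_eq i j t hij ht := by
    rw [imageLen_succ] at ht
    have h1 := h.getElem?_eq i t (by omega)
    have h2 := h.getElem?_eq j t (by rw [← hij]; omega)
    rw [hij, h2] at h1
    exact (Option.some_injective _ h1).symm

theorem MapsSeq.length_iterate_pre (h : MapsSeq σ y y) (n k : ℕ) :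
    ((onWord σ)^[n] (pre y k)).length = (imageLen σ y)^[n] k := by
  induction n generalizing k with
  | zero => simp [pre]
  | succ n ih =>
    rw [Function.iterate_succ_apply, Function.iterate_succ_apply, h k, ih]
    rfl

theorem MapsSeq.iterate_imageLen_succ (h : MapsSeq σ y y) (n j : ℕ) :
    (imageLen σ y)^[n] (j + 1) = (imageLen σ y)^[n] j + (iter σ n (y j)).length := by
  rw [← h.length_iterate_pre, ← h.length_iterate_pre, pre_succ, onWord_iterate_append,
    List.length_append, iter]

theorem MapsSeq.length_iter_zero (hσ : IsSubstitution σ) (h : MapsSeq σ y y) (n : ℕ) :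
    (iter σ n (y 0)).length = (imageLen σ y)^[n] 1 := by
  have h1 := h.iterate_imageLen_succ n 0
  rw [((isBlockMap_imageLen hσ h).iterate n).map_zero, zero_add, zero_add] at h1
  exact h1.symm

/-- The growth type of a monotone sequence is determined along a progression. -/
theorem isTheta_of_monotone {F : ℕ → ℝ} (hF : Monotone F) {p : ℕ} (hp : 0 < p) {d : ℕ}
    {η κ : ℝ} (hη : 1 ≤ η) (hκ : 0 < κ) (h : ExpPolyLim (fun n => F (p * n)) d (η ^ p) κ) :
    F =Θ[atTop] fun n : ℕ => (n : ℝ) ^ d * η ^ n := by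
  have hη0 : 0 < η := zero_lt_one.trans_le hη
  obtain ⟨N₁, hN₁⟩ := eventually_atTop.1 (h.eventually (lt_mem_nhds (show κ / 2 < κ by linarith)))
  obtain ⟨N₂, hN₂⟩ := eventually_atTop.1 (h.eventually (gt_mem_nhds (show κ < 2 * κ by linarith)))
  have hdiv : ∀ n, p * (n / p) ≤ n ∧ n < p * (n / p + 1) := fun n =>
    ⟨Nat.mul_div_le n p, by rw [mul_add, mul_one, mul_comm]; exact Nat.lt_div_mul_add hp⟩
  have hlow : ∀ n ≥ p * (max 1 N₁),
      κ / 2 / ((2 * p) ^ d * η ^ p) * ((n : ℝ) ^ d * η ^ n) ≤ F n := fun n hn => by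
    set q := n / p with hq
    obtain ⟨hq1, hq2⟩ : p * q ≤ n ∧ n < p * (q + 1) := hdiv n
    have hqN : max 1 N₁ ≤ q := (Nat.le_div_iff_mul_le hp).2 (by rwa [mul_comm])
    have hq0 : 1 ≤ q := (le_max_left _ _).trans hqN
    have h1 := hN₁ q ((le_max_right _ _).trans hqN)
    rw [lt_div_iff₀ (scale_pos (by positivity) hq0)] at h1
    have h2 : (n : ℝ) ≤ 2 * p * q := by
      have : n ≤ 2 * p * q := by nlinarith
      exact_mod_cast this
    have h3 : η ^ n ≤ (η ^ p) ^ q * η ^ p := by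
      rw [← pow_mul, ← pow_add]
      exact pow_le_pow_right₀ hη (by rw [mul_add, mul_one] at hq2; omega)
    calc κ / 2 / ((2 * p) ^ d * η ^ p) * ((n : ℝ) ^ d * η ^ n)
        ≤ κ / 2 / ((2 * p) ^ d * η ^ p) * ((2 * p * q : ℝ) ^ d * ((η ^ p) ^ q * η ^ p)) := by
          gcongr
      _ = κ / 2 * ((q : ℝ) ^ d * (η ^ p) ^ q) := by
          rw [mul_pow (2 * (p : ℝ)) (q : ℝ)]
          field_simp
      _ ≤ F (p * q) := h1.le
      _ ≤ F n := hF hq1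
  have hup : ∀ n ≥ max 1 (p * N₂), F n ≤ 2 * κ * 2 ^ d * η ^ p * ((n : ℝ) ^ d * η ^ n) :=
    fun n hn => by
    set q := n / p with hq
    obtain ⟨hq1, hq2⟩ : p * q ≤ n ∧ n < p * (q + 1) := hdiv n
    have hqN : N₂ ≤ q := (Nat.le_div_iff_mul_le hp).2
      (by rw [mul_comm]; exact (le_max_right _ _).trans hn)
    have h1 := hN₂ (q + 1) (by omega)
    rw [div_lt_iff₀ (scale_pos (by positivity) (by omega))] at h1
    have h2 : ((q + 1 : ℕ) : ℝ) ≤ 2 * n := by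
      have h3 : q ≤ n := Nat.div_le_self n p
      have h4 : 1 ≤ n := (le_max_left _ _).trans hn
      exact_mod_cast (by omega : q + 1 ≤ 2 * n)
    have h3 : (η ^ p) ^ (q + 1) ≤ η ^ p * η ^ n := by
      rw [← pow_mul, ← pow_add]
      exact pow_le_pow_right₀ hη (by rw [mul_add, mul_one]; omega)
    calc F n ≤ F (p * (q + 1)) := hF hq2.le
      _ ≤ 2 * κ * (((q + 1 : ℕ) : ℝ) ^ d * (η ^ p) ^ (q + 1)) := h1.le
      _ ≤ 2 * κ * ((2 * n : ℝ) ^ d * (η ^ p * η ^ n)) := by gcongr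
      _ = _ := by rw [mul_pow]; ring
  set c := κ / 2 / ((2 * p) ^ d * η ^ p) with hc
  have hp' : (0 : ℝ) < p := by exact_mod_cast hp
  have hc0 : 0 < c := by positivity
  have hFnn : ∀ n ≥ p * (max 1 N₁), 0 ≤ F n := fun n hn => le_trans (by positivity) (hlow n hn)
  constructor
  · refine IsBigO.of_bound (2 * κ * 2 ^ d * η ^ p) ?_
    filter_upwards [eventually_ge_atTop (p * (max 1 N₁)), eventually_ge_atTop (max 1 (p * N₂))]
      with n hn1 hn2
    rw [Real.norm_of_nonneg (hFnn n hn1), Real.norm_of_nonneg (by positivity)]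
    exact hup n hn2
  · refine IsBigO.of_bound c⁻¹ ?_
    filter_upwards [eventually_ge_atTop (p * (max 1 N₁))] with n hn1
    rw [Real.norm_of_nonneg (hFnn n hn1), Real.norm_of_nonneg (by positivity),
      le_inv_mul_iff₀ hc0]
    exact hlow n hn1

/-- A fixed point has an idempotent block map, whose growth rate is a power of that of the
substitution. -/
theorem exists_gauge_of_hasGrowthType [Finite A] (hσ : IsSubstitution σ) {d : ℕ} {α : ℝ}
    (hσg : HasGrowthType σ d α) (hy : IsProperFixedPoint σ y) :
    ∃ g p d' Λ, 0 < p ∧ IsIdempotentBlockMap y g ∧ IsGauge g d' (α ^ p) Λ := by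
  obtain ⟨hfix, hsurj⟩ := hy
  set g := imageLen σ y
  have hg : IsBlockMap y g := isBlockMap_imageLen hσ hfix
  have hsucc : ∀ n j, g^[n] (j + 1) = g^[n] j + (iter σ n (y j)).length :=
    hfix.iterate_imageLen_succ
  obtain ⟨p, hp, hG⟩ := hg.exists_iterate_isIdempotentBlockMap fun j => by
    simp only [hsucc, Nat.add_sub_cancel_left]
    exact hσ (y j)
  obtain ⟨d', θ, Λ, hΛ⟩ := hG.exists_gauge hsurj
  have hθ0 : 0 < θ := zero_lt_one.trans hΛ.one_lt
  suffices hθ : θ = α ^ p from ⟨g^[p], p, d', Λ, hp, hG, hθ ▸ hΛ⟩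
  -- The rate per application of `σ`, while `θ` is that of `p` applications. Only bases are compared
  -- with `α`; the degree `d'` need not be identified.
  set η := θ ^ ((p : ℝ)⁻¹) with hη
  have hηp : η ^ p = θ := Real.rpow_inv_natCast_pow hθ0.le hp.ne'
  have hη1 : 1 ≤ η := Real.one_le_rpow hΛ.one_lt.le (by positivity)
  have hmono : Monotone fun n => ((iter σ n (y 0)).length : ℝ) :=
    monotone_nat_of_le_succ fun n => by
    rw [hfix.length_iter_zero hσ, hfix.length_iter_zero hσ, Function.iterate_succ_apply]
    exact_mod_cast (hg.iterate n).strictMono.monotone (hg.strictMono.le_apply)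
  have htype : LetterGrowthType σ (y 0) d' η := by
    refine ⟨zero_lt_one.trans_le hη1, isTheta_of_monotone hmono hp hη1 hΛ.one_pos ?_⟩
    rw [hηp]
    refine (hΛ.lim 1).congr fun n => ?_
    simp only [hfix.length_iter_zero hσ, Function.iterate_mul, g]
  have hηα : η ≤ α := by
    rcases hσg.2 _ _ _ htype with h | ⟨h, -⟩
    · exact h.le
    · exact h.le
  obtain ⟨⟨b, hα0, hb⟩, -⟩ := hσg
  -- A letter of rate `α` occurs in `y`, and `blockLen_le` bounds its blocks by the first block one
  -- level up, which would be too short if `θ < α ^ p`.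
  refine le_antisymm (hηp ▸ pow_le_pow_left₀ (by linarith) hηα p) (not_lt.1 fun hlt => ?_)
  obtain ⟨j, rfl⟩ := hsurj b
  obtain ⟨C, hC, hbound⟩ := hb.2.exists_pos
  have hlim := ((hΛ.lim 1).succ hθ0).rescale (d' := 0) hθ0 (tendsto_scale_div_of_lt hθ0 hlt)
  have hev : ∀ᶠ n : ℕ in atTop, C⁻¹ ≤ ((g^[p])^[n + 1] 1 : ℝ) / ((n : ℝ) ^ 0 * (α ^ p) ^ n) := by
    filter_upwards [(tendsto_id.const_mul_atTop' hp).eventually hbound.bound,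
      eventually_ge_atTop 1] with n hn hn1
    simp only [id_eq] at hn
    rw [Real.norm_of_nonneg (by positivity), Real.norm_of_nonneg (by positivity)] at hn
    have h1 : blockLen g^[p] n j = (iter σ (p * n) (y j)).length := by
      rw [blockLen, ← Function.iterate_mul, hsucc]
      push_cast
      ring
    have h2 := hG.blockLen_le n j
    rw [h1] at h2
    have h3 : (1 : ℝ) ≤ ((p * n : ℕ) : ℝ) ^ d :=
      one_le_pow₀ (by exact_mod_cast Nat.mul_pos hp hn1)
    rw [pow_zero, one_mul, le_div_iff₀ (by positivity), inv_mul_le_iff₀ hC, ← pow_mul]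
    calc α ^ (p * n) ≤ ((p * n : ℕ) : ℝ) ^ d * α ^ (p * n) :=
          le_mul_of_one_le_left (by positivity) h3
      _ ≤ _ := hn
      _ ≤ _ := mul_le_mul_of_nonneg_left h2 hC.le
  have := ge_of_tendsto hlim hev
  have := inv_pos.2 hC
  linarith

theorem MulIndep.pow {α β : ℝ} (h : MulIndep α β) {p q : ℕ} (hp : 0 < p) (hq : 0 < q) :
    MulIndep (α ^ p) (β ^ q) := fun k l hk hl => by
  rw [← pow_mul, ← pow_mul]
  exact h _ _ (Nat.mul_pos hp hk) (Nat.mul_pos hq hl)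

end Subst

theorem mainTheorem3 {A B C : Type*} [Finite A] [Finite B] (α β : ℝ)
    (hα : Subst.IsPerron α) (hβ : Subst.IsPerron β) (hαβ : Subst.MulIndep α β)
    (σ : A → List A) (τ : B → List B)
    (hσ : Subst.IsSubstitution σ) (hτ : Subst.IsSubstitution τ)
    (d e : ℕ) (hσg : Subst.HasGrowthType σ d α) (hτg : Subst.HasGrowthType τ e β)
    (y : ℕ → A) (z : ℕ → B)
    (hy : Subst.IsProperFixedPoint σ y) (hz : Subst.IsProperFixedPoint τ z)
    (φ : A → C) (ψ : B → C) (x : ℕ → C) (hxy : φ ∘ y = x) (hxz : ψ ∘ z = x)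
    (c : C) (hc : {n | x n = c}.Infinite) :
    Subst.BoundedGaps x c := by
  obtain ⟨g, p, d', Λ, hp, hg, hΛ⟩ := Subst.exists_gauge_of_hasGrowthType hσ hσg hy
  obtain ⟨h, q, e', M, hq, hh, hM⟩ := Subst.exists_gauge_of_hasGrowthType hτ hτg hz
  refine Subst.bounded_gaps_of_mulIndep hg hh hy.2 hz.2 (fun i j hij => ?_) (fun i j hij => ?_)
    hΛ hM (hαβ.pow hp hq) hc
  · change x i = c ↔ x j = c
    rw [← hxy, Function.comp_apply, Function.comp_apply, hij]
  · change x i = c ↔ x j = c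
    rw [← hxz, Function.comp_apply, Function.comp_apply, hij]
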